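/- Let $n\ge 2$ and consider $n$ qubits on a line, with stabilizer generators $K_1=X_1Z_2$, $K_i=Z_{i-1}X_iZ_{i+1}$ ($1<i<n$), $K_n=Z_{n-1}X_n$; let $|C_n\rangle$ be the linear cluster state, i.e. $|+\rangle^{\otimes n}$ followed by controlled-$Z$ gates between neighbouring qubits. For a two-qubit state $\tau$ shared by Alice and Bob, let $F_T(\tau)$ be its teleportation fidelity: Alice measures the input qubit and her half of $\tau$ in the Bell basis, Bob applies a unitary depending on her result, the fidelity of his output with the pure input state is averaged uniformly over the Bloch sphere, and the supremum is taken over Bob's choices of unitaries. Let $F(\tau)=\max_U\langle\phi^+|(1\otimes U)\tau(1\otimes U^\dagger)|\phi^+\rangle$ be the fully entangled fraction, where $|\phi^+\rangle=(|00\rangle+|11\rangle)/\sqrt2$. Then $F_T(\tau)=\frac13(1+2F(\tau))$ for every two-qubit state $\tau$. Fix for each of the qubits $2,\dots,n-1$ a measurement basis, $X$ or $Y$. For an $n$-qubit state $\rho$ let $p_s$ be the probability of the outcome string $s$ and $\rho_s$ the resulting state of qubits $1$ and $n$, and put $F_T(\rho)=\sum_s p_s F_T(\rho_s)$. For each such choice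 of bases the following holds. 1. If $c\in\mathbb R$ and $\rho$ is an $n$-qubit state with $\mathrm{Tr}(K_i\rho)\ge c$ for all $i$ (in particular if all these expectation values equal $c=\langle ZXZ\rangle$), then $$F_T(\rho)\ \ge\ 1-\frac n3(1-c).$$ 2. There is a choice of Bob's unitary corrections, depending only on $s$ and on Alice's Bell result (not on $\rho$ or $c$), for which the average teleportation fidelity already satisfies this bound for all $c$ and $\rho$ as in 1, and for which the bound is attained, for every outcome $s$, by the worst-case state $$\rho_n^{WC}=\lambda|C_n\rangle\langle C_n|+\frac{1-\lambda}{n}\sum_{i=1}^n Z_i|C_n\rangle\langle C_n|Z_i,\qquad \lambda=1-\frac n2(1-c),$$ for every $c\le 1$ with $n(1-c)\le 2$ (i.e. $0\le\lambda\le1$). 3. For every $c\le 1$ with $n(1-c)\le 2$, $\rho_n^{WC}$ is a state with $\mathrm{Tr}(K_i\rho_n^{WC})=c$ for all $i$, and each outcome $s$ has positive probability and leaves qubits $1$ and $n$ in a state of teleportation fidelity $F_T\ge 1-\frac n3(1-c)$. 4. The bound is tight: if moreover $n(1-c)\le 1$ (i.e. the bound is at least the classical value $2/3$), then for $\rho_n^{WC}$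 every outcome $s$ leaves a state with $F_T=1-\frac n3(1-c)$, and $F_T(\rho_n^{WC})=1-\frac n3(1-c)$. -/

import Mathlib

open scoped Kronecker ComplexOrder

noncomputable section

namespace LinearCluster

/-- Single-qubit operators, in the computational basis. -/
abbrev QubitOp := Matrix (Fin 2) (Fin 2) ℂ

/-- The Pauli operators `X`, `Y`, `Z`. -/
def pauliX : QubitOp := !![0, 1; 1, 0]

def pauliY : QubitOp := !![0, -Complex.I; Complex.I, 0]

def pauliZ : QubitOp := !![1, 0; 0, -1]

/-- Operators on `n` qubits; computational basis states are labelled by bit strings. -/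
abbrev Op (n : ℕ) := Matrix (Fin n → Fin 2) (Fin n → Fin 2) ℂ

/-- Operators on a pair of qubits (Alice's qubit, Bob's qubit). -/
abbrev PairOp := Matrix (Fin 2 × Fin 2) (Fin 2 × Fin 2) ℂ

/-- Quantum states: positive semidefinite matrices of trace one. -/
def IsState {ι : Type} [Fintype ι] (ρ : Matrix ι ι ℂ) : Prop :=
  ρ.PosSemidef ∧ ρ.trace = 1

/-- The expectation value `Tr (A ρ)` of a Hermitian operator `A`. -/
def expect {ι : Type} [Fintype ι] (A ρ : Matrix ι ι ℂ) : ℝ := (A * ρ).trace.re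

/-- The number `⟨v| M |v⟩`, for Hermitian `M`. -/
def sandwich {ι : Type} [Fintype ι] (v : ι → ℂ) (M : Matrix ι ι ℂ) : ℝ :=
  (star v ⬝ᵥ (M.mulVec v)).re

/-- The tensor product `A₁ ⊗ ⋯ ⊗ Aₙ` of single-qubit operators. -/
def tensor {n : ℕ} (A : Fin n → QubitOp) : Op n :=
  Matrix.of fun x y => ∏ i, A i (x i) (y i)

/-! ### The linear cluster state and its stabilizer generators -/

/-- The stabilizer generator `K i` of the linear cluster state: `X` on qubit `i` and `Z` on its
neighbours on the line. In the bulk this is `Z X Z`; at the two ends it is `X Z` and `Z X`. -/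
def gen {n : ℕ} (i : Fin n) : Op n :=
  tensor fun j =>
    if j = i then pauliX
    else if (j : ℕ) + 1 = (i : ℕ) ∨ (i : ℕ) + 1 = (j : ℕ) then pauliZ
    else 1

/-- `Z` on qubit `i`. -/
def opZ {n : ℕ} (i : Fin n) : Op n :=
  tensor fun j => if j = i then pauliZ else 1

/-- The linear cluster state: all qubits in `|+⟩`, followed by controlled-`Z` gates between
neighbours. -/
def clusterVec (n : ℕ) (x : Fin n → Fin 2) : ℂ :=
  ((1 / Real.sqrt 2 : ℝ) : ℂ) ^ n *
    ∏ i : Fin n, ∏ j : Fin n,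
      if (i : ℕ) + 1 = (j : ℕ) ∧ x i = 1 ∧ x j = 1 then (-1 : ℂ) else 1

/-- The projector onto the linear cluster state. -/
def clusterProj (n : ℕ) : Op n :=
  Matrix.vecMulVec (clusterVec n) (star (clusterVec n))

/-- The weight of the ideal cluster state in the worst-case state. -/
def wcWeight (n : ℕ) (c : ℝ) : ℝ := 1 - n * (1 - c) / 2

/-- The worst-case state on `n` qubits with generator expectation value `c`. -/
def wcState (n : ℕ) (c : ℝ) : Op n :=
  (wcWeight n c : ℂ) • clusterProj n +
    (((1 - wcWeight n c) / n : ℝ) : ℂ) • ∑ i : Fin n, opZ i * clusterProj n * opZ i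

/-! ### Measuring the inner qubits of a line of `k + 2` qubits -/

/-- The two bases in which an inner qubit may be measured. -/
inductive MeasBasis : Type
  | X
  | Y

/-- The observable that belongs to a basis. -/
def MeasBasis.obs : MeasBasis → QubitOp
  | .X => pauliX
  | .Y => pauliY

/-- The projector onto outcome `(-1) ^ s` of a single-qubit measurement. -/
def outcomeProj (b : MeasBasis) (s : Fin 2) : QubitOp :=
  (1 / 2 : ℂ) • (1 + (-1 : ℂ) ^ (s : ℕ) • b.obs)

/-- The family `(a, z₁, …, z_k, b)` with `k + 2` members. -/
def frame {α : Type} {k : ℕ} (a : α) (z : Fin k → α) (b : α) : Fin (k + 2) → α :=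
  Fin.cons (α := fun _ => α) a (Fin.snoc (α := fun _ => α) z b)

/-- The projector `1 ⊗ P₁ ⊗ ⋯ ⊗ P_k ⊗ 1` for the outcome string `s` of the measurements `m` on the
`k` inner qubits. -/
def measProj {k : ℕ} (m : Fin k → MeasBasis) (s : Fin k → Fin 2) : Op (k + 2) :=
  tensor (frame 1 (fun i => outcomeProj (m i) (s i)) 1)

/-- The partial trace over the inner qubits; the first and the last qubit are kept. -/
def traceInner {k : ℕ} (ρ : Op (k + 2)) : PairOp :=
  Matrix.of fun p q => ∑ z : Fin k → Fin 2, ρ (frame p.1 z p.2) (frame q.1 z q.2)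

/-- The probability of the outcome string `s`. -/
def outcomeProb {k : ℕ} (m : Fin k → MeasBasis) (ρ : Op (k + 2)) (s : Fin k → Fin 2) : ℝ :=
  expect (measProj m s) ρ

/-- The state of the first and the last qubit after the measurements `m` with outcomes `s`
(meaningful when the outcome has nonzero probability). -/
def postState {k : ℕ} (m : Fin k → MeasBasis) (ρ : Op (k + 2)) (s : Fin k → Fin 2) : PairOp :=
  ((outcomeProb m ρ s : ℂ))⁻¹ • traceInner (measProj m s * ρ * measProj m s)

/-! ### Teleportation through a pair of qubits -/

/-- The Bell vectors `(σⱼ ⊗ 1)|φ⁺⟩` with `σ₀, …, σ₃ = 1, X, Y, Z`; index `0` is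
`|φ⁺⟩ = (|00⟩ + |11⟩) / √2` itself. -/
def bellVec (j : Fin 4) (p : Fin 2 × Fin 2) : ℂ :=
  ((1 / Real.sqrt 2 : ℝ) : ℂ) * (![1, pauliX, pauliY, pauliZ] j : QubitOp) p.1 p.2

/-- `⟨φ⁺| (1 ⊗ U) τ (1 ⊗ U†) |φ⁺⟩`. -/
def bellOverlap (τ : PairOp) (U : Matrix.unitaryGroup (Fin 2) ℂ) : ℝ :=
  sandwich (bellVec 0)
    (((1 : QubitOp) ⊗ₖ (U : QubitOp)) * τ * ((1 : QubitOp) ⊗ₖ (U : QubitOp).conjTranspose))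

/-- The fully entangled fraction. -/
def fullyEntangledFraction (τ : PairOp) : ℝ :=
  ⨆ U : Matrix.unitaryGroup (Fin 2) ℂ, bellOverlap τ U

/-- Bob's unnormalized state `⟨Φⱼ| (|ψ⟩⟨ψ| ⊗ τ) |Φⱼ⟩` after Alice has found the Bell vector `Φⱼ` in a
measurement of the input qubit, in state `ψ`, together with her half of `τ`. Its trace is the
probability of that outcome. -/
def bobState (τ : PairOp) (ψ : Fin 2 → ℂ) (j : Fin 4) : QubitOp :=
  Matrix.of fun b b' => ∑ c : Fin 2, ∑ a : Fin 2, ∑ c' : Fin 2, ∑ a' : Fin 2,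
    star (bellVec j (c, a)) * (ψ c * star (ψ c') * τ (a, b) (a', b')) * bellVec j (c', a')

/-- The fidelity with which the pure state `ψ` is teleported through `τ` if Bob applies the unitary
`V j` on learning Alice's result `j`. -/
def inputFidelity (τ : PairOp) (V : Fin 4 → Matrix.unitaryGroup (Fin 2) ℂ) (ψ : Fin 2 → ℂ) : ℝ :=
  ∑ j : Fin 4, sandwich ψ ((V j : QubitOp) * bobState τ ψ j * (V j : QubitOp).conjTranspose)

/-- The pure qubit state with polar angle `θ` and azimuth `φ` on the Bloch sphere. -/
def blochVec (θ φ : ℝ) : Fin 2 → ℂ :=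
  ![(Real.cos (θ / 2) : ℂ), Complex.exp (Complex.I * φ) * (Real.sin (θ / 2) : ℂ)]

/-- The fidelity of teleportation with Bob's corrections `V`, averaged over all pure inputs
(uniformly on the Bloch sphere). -/
def fidelityWith (τ : PairOp) (V : Fin 4 → Matrix.unitaryGroup (Fin 2) ℂ) : ℝ :=
  (1 / (4 * Real.pi)) *
    ∫ φ in (0 : ℝ)..(2 * Real.pi), ∫ θ in (0 : ℝ)..Real.pi,
      inputFidelity τ V (blochVec θ φ) * Real.sin θ

/-- The teleportation fidelity of `τ`: the average fidelity for the best choice of Bob's unitary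
corrections. -/
def teleportFidelity (τ : PairOp) : ℝ :=
  ⨆ V : Fin 4 → Matrix.unitaryGroup (Fin 2) ℂ, fidelityWith τ V

/-- The fidelity of teleportation between the first and the last qubit of `ρ`, after the inner
qubits have been measured in the bases `m`; the outcomes are known, and the result is averaged over
them. -/
def localizedFidelity {k : ℕ} (m : Fin k → MeasBasis) (ρ : Op (k + 2)) : ℝ :=
  ∑ s : Fin k → Fin 2, outcomeProb m ρ s * teleportFidelity (postState m ρ s)

/-- The same quantity for a fixed list of Bob's corrections: `V s j` is applied if the inner qubits
gave the outcomes `s` and Alice's Bell measurement gave `j`. -/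
def localizedFidelityWith {k : ℕ} (m : Fin k → MeasBasis)
    (V : (Fin k → Fin 2) → Fin 4 → Matrix.unitaryGroup (Fin 2) ℂ) (ρ : Op (k + 2)) : ℝ :=
  ∑ s : Fin k → Fin 2, outcomeProb m ρ s * fidelityWith (postState m ρ s) (V s)

end LinearCluster

end

/-!
The average over the Bloch sphere of `⟨ψ| A |ψ⟩ ⟨ψ| B |ψ⟩` is `(tr A tr B + tr (A B)) / 6`, so the
fidelity of teleportation is an affine function of the overlaps of `τ` with four maximally entangled
states, one for each result of the Bell measurement. Bob optimizes each of them separately.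

The generators act on the graph basis `∏ Zᵢ ^ wᵢ |Cₙ⟩` by the signs `(-1) ^ wᵢ`. Their sum over `i`
is `n` at `w = 0` and at most `n - 2` elsewhere, so expectation values of at least `c` force a
weight of at least `1 - n (1 - c) / 2` on the cluster state. The worst-case state attains it,
because a single `Z` error gives exactly `n - 2`.

In the matrix product form of the cluster state a measured inner qubit becomes a phase gate between
two Hadamard gates. Every outcome therefore turns a graph basis state into a maximally entangled
state of the outer qubits, and the overlap with the cluster state is carried over to Bob's
fidelity. A single `Z` error multiplies the unitary of the maximally entangled state by a conjugate
of `Z`, which has trace zero. The states left by the worst-case state are thus mixtures in which the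
ideal state is orthogonal to all the others, and no maximally entangled state does better as long as
its weight is at least `1 / 2`.
-/

noncomputable section

namespace LinearCluster

open Matrix
open scoped MatrixOrder

/-! ### Expectation values -/

section ExpectationValues

variable {ι κ : Type} [Fintype ι] [Fintype κ]

theorem expect_add_right (A ρ σ : Matrix ι ι ℂ) :
    expect A (ρ + σ) = expect A ρ + expect A σ := by
  simp [expect, mul_add]

theorem expect_smul_right (A : Matrix ι ι ℂ) (a : ℝ) (ρ : Matrix ι ι ℂ) :
    expect A ((a : ℂ) • ρ) = a * expect A ρ := by
  simp [expect]

theorem expect_sum_right {α : Type*} (A : Matrix ι ι ℂ) (s : Finset α) (ρ : α → Matrix ι ι ℂ) :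
    expect A (∑ i ∈ s, ρ i) = ∑ i ∈ s, expect A (ρ i) := by
  simp [expect, Finset.mul_sum]

theorem expect_comm (A B : Matrix ι ι ℂ) : expect A B = expect B A := by
  rw [expect, trace_mul_comm, expect]

theorem expect_vecMulVec_right (A : Matrix ι ι ℂ) (v : ι → ℂ) :
    expect A (vecMulVec v (star v)) = sandwich v A := by
  rw [expect, mul_vecMulVec, trace_vecMulVec, dotProduct_comm, sandwich]

theorem sandwich_smul_right (v : ι → ℂ) (a : ℝ) (M : Matrix ι ι ℂ) :
    sandwich v ((a : ℂ) • M) = a * sandwich v M := by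
  simp only [← expect_vecMulVec_right, expect_comm _ (vecMulVec v _), expect_smul_right]

theorem sandwich_sum_right {α : Type*} (v : ι → ℂ) (s : Finset α) (M : α → Matrix ι ι ℂ) :
    sandwich v (∑ i ∈ s, M i) = ∑ i ∈ s, sandwich v (M i) := by
  simp only [← expect_vecMulVec_right, expect_comm _ (vecMulVec v _), expect_sum_right]

theorem sandwich_nonneg {M : Matrix ι ι ℂ} (hM : M.PosSemidef) (v : ι → ℂ) : 0 ≤ sandwich v M :=
  hM.re_dotProduct_nonneg v

theorem sandwich_smul_left (a : ℂ) (v : ι → ℂ) (M : Matrix ι ι ℂ) :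
    sandwich (a • v) M = Complex.normSq a * sandwich v M := by
  rw [sandwich, mulVec_smul, dotProduct_smul, star_smul, smul_dotProduct, smul_smul,
    Complex.star_def, Complex.mul_conj, smul_eq_mul, Complex.re_ofReal_mul, sandwich]

theorem sandwich_vecMulVec (v u : ι → ℂ) :
    sandwich v (vecMulVec u (star u)) = Complex.normSq (star u ⬝ᵥ v) := by
  rw [sandwich, vecMulVec_mulVec, dotProduct_smul, star_dotProduct, MulOpposite.smul_eq_mul_unop,
    MulOpposite.unop_op, Complex.star_def, Complex.mul_conj, Complex.ofReal_re, Complex.normSq_conj]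

theorem sandwich_mul_mul_conjTranspose (v : κ → ℂ) (A : Matrix κ ι ℂ) (M : Matrix ι ι ℂ) :
    sandwich v (A * M * Aᴴ) = sandwich (Aᴴ *ᵥ v) M := by
  rw [sandwich, sandwich, ← mulVec_mulVec, ← mulVec_mulVec, dotProduct_mulVec, star_mulVec,
    conjTranspose_conjTranspose]

theorem sandwich_conjTranspose_mul_self (v : ι → ℂ) (B : Matrix κ ι ℂ) :
    sandwich v (Bᴴ * B) = ∑ i, ‖(B *ᵥ v) i‖ ^ 2 := by
  rw [sandwich, ← mulVec_mulVec, dotProduct_mulVec, ← star_mulVec]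
  simp only [dotProduct, Complex.re_sum, Pi.star_apply, Complex.star_def, Complex.conj_mul',
    ← Complex.ofReal_pow, Complex.ofReal_re]

theorem sandwich_sum_le {M : Matrix ι ι ℂ} (hM : M.PosSemidef) (v : κ → ι → ℂ) :
    sandwich (∑ s, v s) M ≤ Fintype.card κ * ∑ s, sandwich (v s) M := by
  classical
  obtain ⟨B, rfl⟩ := CStarAlgebra.nonneg_iff_eq_star_mul_self.1 hM.nonneg
  simp only [star_eq_conjTranspose, sandwich_conjTranspose_mul_self]
  rw [Finset.sum_comm, Finset.mul_sum]
  refine Finset.sum_le_sum fun i _ => ?_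
  calc ‖(B *ᵥ ∑ s, v s) i‖ ^ 2 = ‖∑ s, (B *ᵥ v s) i‖ ^ 2 := by
        rw [mulVec_sum, Finset.sum_apply]
    _ ≤ (∑ s, ‖(B *ᵥ v s) i‖) ^ 2 := by gcongr; exact norm_sum_le _ _
    _ ≤ _ := sq_sum_le_card_mul_sum_sq

theorem sandwich_le_sum_norm {v : ι → ℂ} (hv : ∀ i, ‖v i‖ ≤ 1) (M : Matrix ι ι ℂ) :
    sandwich v M ≤ ∑ i, ∑ j, ‖M i j‖ := by
  refine (Complex.re_le_norm _).trans ((norm_sum_le _ _).trans ?_)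
  refine Finset.sum_le_sum fun i _ => ?_
  rw [Pi.star_apply, norm_mul, norm_star]
  refine (mul_le_of_le_one_left (norm_nonneg _) (hv i)).trans ((norm_sum_le _ _).trans ?_)
  refine Finset.sum_le_sum fun j _ => ?_
  rw [norm_mul]
  exact mul_le_of_le_one_right (norm_nonneg _) (hv j)

theorem normSq_add_normSq_le_one {u v w : ι → ℂ} (hu : star u ⬝ᵥ u = 1) (hv : star v ⬝ᵥ v = 1)
    (huv : star u ⬝ᵥ v = 0) (hw : star w ⬝ᵥ w = 1) :
    Complex.normSq (star u ⬝ᵥ w) + Complex.normSq (star v ⬝ᵥ w) ≤ 1 := by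
  have hvu : star v ⬝ᵥ u = 0 := by rw [star_dotProduct, huv, star_zero]
  have inner_toLp : ∀ x y : ι → ℂ, inner ℂ (WithLp.toLp 2 x) (WithLp.toLp 2 y) = star x ⬝ᵥ y :=
    fun x y => dotProduct_comm y (star x)
  have orthonormal : Orthonormal ℂ ![WithLp.toLp 2 u, WithLp.toLp 2 v] := by
    rw [orthonormal_iff_ite, Fin.forall_fin_two, Fin.forall_fin_two, Fin.forall_fin_two]
    simp only [cons_val_zero, cons_val_one, inner_toLp, hu, hv, huv, hvu]
    simp
  have bessel := orthonormal.sum_inner_products_le (WithLp.toLp 2 w) (s := Finset.univ)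
  simpa only [Fin.sum_univ_two, cons_val_zero, cons_val_one, inner_toLp,
    @norm_sq_eq_re_inner ℂ _ _ _ _ (WithLp.toLp 2 w), hw, RCLike.one_re,
    ← Complex.normSq_eq_norm_sq] using bessel

theorem trace_vecMulVec_star_self {v : ι → ℂ} (hv : star v ⬝ᵥ v = 1) :
    (vecMulVec v (star v)).trace = 1 := by
  rw [trace_vecMulVec, dotProduct_comm, hv]

end ExpectationValues

/-! ### Mixtures of pure states -/

section Mixtures

variable {ι κ : Type} [Fintype κ] (t : ℝ) (u : ι → ℂ) (v : κ → ι → ℂ)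

/-- The mixture of the pure state `|u⟩` with weight `t` and of the pure states `|v i⟩` with equal
shares of the remaining weight: the form of the worst-case state before and after the measurement of
the inner qubits. -/
def mixture : Matrix ι ι ℂ :=
  (t : ℂ) • vecMulVec u (star u) +
    (((1 - t) / Fintype.card κ : ℝ) : ℂ) • ∑ i, vecMulVec (v i) (star (v i))

theorem mixture_smul (a : ℂ) :
    mixture t (a • u) (fun i => a • v i) = (Complex.normSq a : ℂ) • mixture t u v := by
  simp only [mixture, star_smul, smul_vecMulVec, vecMulVec_smul, smul_smul, ← Finset.smul_sum,
    smul_add, Complex.star_def, ← Complex.normSq_eq_conj_mul_self,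
    mul_comm _ (Complex.normSq a : ℂ)]

variable [Fintype ι]

theorem expect_mixture (A : Matrix ι ι ℂ) :
    expect A (mixture t u v) =
      t * sandwich u A + (1 - t) / Fintype.card κ * ∑ i, sandwich (v i) A := by
  simp only [mixture, expect_add_right, expect_smul_right, expect_sum_right,
    expect_vecMulVec_right]

theorem sandwich_mixture (w : ι → ℂ) :
    sandwich w (mixture t u v) = t * Complex.normSq (star u ⬝ᵥ w) +
      (1 - t) / Fintype.card κ * ∑ i, Complex.normSq (star (v i) ⬝ᵥ w) := by
  rw [← expect_vecMulVec_right, expect_comm, expect_mixture]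
  simp only [← expect_vecMulVec_right, expect_comm (vecMulVec w _), ← sandwich_vecMulVec]

theorem mul_mixture_mul_conjTranspose {ι' : Type} (M : Matrix ι' ι ℂ) :
    M * mixture t u v * Mᴴ = mixture t (M *ᵥ u) fun i => M *ᵥ v i := by
  simp only [mixture, Matrix.mul_add, Matrix.add_mul, Matrix.mul_smul, Matrix.smul_mul,
    Matrix.mul_sum, Matrix.sum_mul, mul_vecMulVec, vecMulVec_mul, star_mulVec]

variable {t u v}

theorem sandwich_mixture_self (hu : star u ⬝ᵥ u = 1) (huv : ∀ i, star u ⬝ᵥ v i = 0) :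
    sandwich u (mixture t u v) = t := by
  have hvu : ∀ i, star (v i) ⬝ᵥ u = 0 := fun i => by rw [star_dotProduct, huv, star_zero]
  simp [sandwich_mixture, hu, hvu]

variable [Nonempty κ]

theorem trace_mixture (hu : star u ⬝ᵥ u = 1) (hv : ∀ i, star (v i) ⬝ᵥ v i = 1) :
    (mixture t u v).trace = 1 := by
  have card_ne_zero : (Fintype.card κ : ℂ) ≠ 0 := Nat.cast_ne_zero.2 Fintype.card_ne_zero
  simp only [mixture, trace_add, trace_smul, trace_sum, trace_vecMulVec_star_self hu,
    trace_vecMulVec_star_self (hv _), Finset.sum_const, Finset.card_univ, smul_eq_mul,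
    nsmul_eq_mul, mul_one]
  push_cast
  field_simp
  ring

theorem isState_mixture (h0 : 0 ≤ t) (h1 : t ≤ 1) (hu : star u ⬝ᵥ u = 1)
    (hv : ∀ i, star (v i) ⬝ᵥ v i = 1) : IsState (mixture t u v) := by
  refine ⟨.add ((posSemidef_vecMulVec_self_star u).smul (Complex.zero_le_real.2 h0))
    ((posSemidef_sum _ fun i _ => posSemidef_vecMulVec_self_star (v i)).smul
      (Complex.zero_le_real.2 ?_)), trace_mixture hu hv⟩
  exact div_nonneg (sub_nonneg.2 h1) (Nat.cast_nonneg _)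

theorem sandwich_mixture_le (h0 : 1 / 2 ≤ t) (h1 : t ≤ 1) (hu : star u ⬝ᵥ u = 1)
    (hv : ∀ i, star (v i) ⬝ᵥ v i = 1) (huv : ∀ i, star u ⬝ᵥ v i = 0) {w : ι → ℂ}
    (hw : star w ⬝ᵥ w = 1) : sandwich w (mixture t u v) ≤ t := by
  set p := Complex.normSq (star u ⬝ᵥ w)
  have bessel : ∀ i, Complex.normSq (star (v i) ⬝ᵥ w) ≤ 1 - p := fun i => by
    linarith [normSq_add_normSq_le_one hu (hv i) (huv i) hw]
  have p_le_one : p ≤ 1 := by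
    linarith [(Complex.normSq_nonneg _).trans (bessel (Classical.arbitrary κ))]
  have card_pos : (0 : ℝ) < Fintype.card κ := Nat.cast_pos.2 Fintype.card_pos
  calc sandwich w (mixture t u v)
      = t * p + (1 - t) / Fintype.card κ * ∑ i, Complex.normSq (star (v i) ⬝ᵥ w) :=
        sandwich_mixture t u v w
    _ ≤ t * p + (1 - t) / Fintype.card κ * ∑ _i : κ, (1 - p) := by
        have := div_nonneg (sub_nonneg.2 h1) card_pos.le
        gcongr with i
        exact bessel i
    _ = t * p + (1 - t) * (1 - p) := by
        rw [Finset.sum_const, Finset.card_univ, nsmul_eq_mul, ← mul_assoc,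
          div_mul_cancel₀ _ card_pos.ne']
    _ ≤ t := by nlinarith

end Mixtures

/-! ### Averages over the Bloch sphere -/

section BlochSphere

open Real

/-- The average of a function of a pure qubit state over the Bloch sphere. -/
def blochAverage (F : (Fin 2 → ℂ) → ℝ) : ℝ :=
  (1 / (4 * π)) * ∫ φ in (0 : ℝ)..(2 * π), ∫ θ in (0 : ℝ)..π, F (blochVec θ φ) * sin θ

/-- The operators `1, X, Y, Z` as unitaries. -/
def pauliUnitary (j : Fin 4) : unitaryGroup (Fin 2) ℂ :=
  ⟨![1, pauliX, pauliY, pauliZ] j, by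
    rw [mem_unitaryGroup_iff]
    fin_cases j <;> ext a b <;> fin_cases a <;> fin_cases b <;>
      simp [pauliX, pauliY, pauliZ, mul_apply, star_apply]⟩

/-- The factor depending on `θ` of the Bloch vector `(1, x, y, z)`, extended by the coefficient `1`
of the identity. -/
def polarFactor (μ : Fin 4) (θ : ℝ) : ℝ := ![1, sin θ, sin θ, cos θ] μ

/-- The factor depending on `φ` of the Bloch vector `(1, x, y, z)`, extended by the coefficient `1`
of the identity. -/
def azimuthFactor (μ : Fin 4) (φ : ℝ) : ℝ := ![1, cos φ, sin φ, 1] μ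

theorem vecMulVec_blochVec (θ φ : ℝ) :
    vecMulVec (blochVec θ φ) (star (blochVec θ φ)) = (1 / 2 : ℂ) •
      ∑ μ, ((polarFactor μ θ * azimuthFactor μ φ : ℝ) : ℂ) • (pauliUnitary μ : QubitOp) := by
  have sin_eq : sin θ = 2 * sin (θ / 2) * cos (θ / 2) := by
    rw [← sin_two_mul, mul_div_cancel₀ θ two_ne_zero]
  have cos_eq : cos θ = 2 * cos (θ / 2) ^ 2 - 1 := by
    rw [← cos_two_mul, mul_div_cancel₀ θ two_ne_zero]
  have half_angle := sin_sq_add_cos_sq (θ / 2)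
  have azimuth := sin_sq_add_cos_sq φ
  have exp_eq : Complex.exp (Complex.I * φ) = ⟨cos φ, sin φ⟩ := by
    rw [mul_comm, Complex.exp_mul_I]
    apply Complex.ext <;> simp [← Complex.ofReal_cos, ← Complex.ofReal_sin]
  simp only [blochVec, exp_eq, Fin.sum_univ_four, polarFactor, azimuthFactor, sin_eq, cos_eq]
  generalize sin (θ / 2) = s at *
  generalize cos (θ / 2) = c at *
  generalize sin φ = s' at *
  generalize cos φ = c' at *
  ext q p
  fin_cases q <;> fin_cases p <;> apply Complex.ext <;>
    simp [pauliUnitary, pauliX, pauliY, pauliZ, vecMulVec_apply, pow_two] <;> try ring_nf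
  · linear_combination half_angle + s ^ 2 * azimuth

theorem integral_polarFactor (μ ν : Fin 4) :
    ∫ θ in (0 : ℝ)..π, polarFactor μ θ * polarFactor ν θ * sin θ =
      !![2, π / 2, π / 2, 0; π / 2, 4 / 3, 4 / 3, 0; π / 2, 4 / 3, 4 / 3, 0; 0, 0, 0, 2 / 3]
        μ ν := by
  have sin_sq_mul_sin : ∀ θ, sin θ ^ 2 * sin θ = sin θ ^ 3 := fun θ => by ring
  have sin_mul_cos_mul_sin : ∀ θ, sin θ * cos θ * sin θ = sin θ ^ 2 * cos θ := fun θ => by ring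
  have cos_sq_mul_sin : ∀ θ, cos θ ^ 2 * sin θ = sin θ * cos θ ^ 2 := fun θ => by ring
  fin_cases μ <;> fin_cases ν <;>
    simp [polarFactor, mul_comm (cos _) (sin _), ← sq, sin_sq_mul_sin, sin_mul_cos_mul_sin,
      cos_sq_mul_sin] <;> norm_num

theorem integral_azimuthFactor (μ ν : Fin 4) :
    ∫ φ in (0 : ℝ)..(2 * π), azimuthFactor μ φ * azimuthFactor ν φ =
      !![2 * π, 0, 0, 2 * π; 0, π, 0, 0; 0, 0, π, 0; 2 * π, 0, 0, 2 * π] μ ν := by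
  fin_cases μ <;> fin_cases ν <;>
    simp [azimuthFactor, mul_comm (cos _) (sin _), ← sq]

theorem continuous_polarFactor (μ : Fin 4) : Continuous (polarFactor μ) := by
  fin_cases μ
  exacts [continuous_const, continuous_sin, continuous_sin, continuous_cos]

theorem continuous_azimuthFactor (μ : Fin 4) : Continuous (azimuthFactor μ) := by
  fin_cases μ
  exacts [continuous_const, continuous_cos, continuous_sin, continuous_const]

theorem sphere_average_quadraticForm (g : Fin 4 → Fin 4 → ℝ) :
    (1 / (4 * π)) * ∫ φ in (0 : ℝ)..(2 * π), ∫ θ in (0 : ℝ)..π,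
      (∑ μ, ∑ ν, g μ ν * ((polarFactor μ θ * azimuthFactor μ φ) *
        (polarFactor ν θ * azimuthFactor ν φ))) * sin θ =
    g 0 0 + (g 1 1 + g 2 2 + g 3 3) / 3 := by
  have inner : ∀ φ, ∫ θ in (0 : ℝ)..π, (∑ μ, ∑ ν, g μ ν *
      ((polarFactor μ θ * azimuthFactor μ φ) * (polarFactor ν θ * azimuthFactor ν φ))) * sin θ =
      ∑ μ, ∑ ν, (g μ ν * ∫ θ in (0 : ℝ)..π, polarFactor μ θ * polarFactor ν θ * sin θ) *
        (azimuthFactor μ φ * azimuthFactor ν φ) := by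
    intro φ
    have := continuous_polarFactor
    simp only [← intervalIntegral.integral_const_mul, ← intervalIntegral.integral_mul_const,
      Finset.sum_mul, ← Fintype.sum_prod_type']
    rw [intervalIntegral.integral_finsetSum fun p _ =>
      Continuous.intervalIntegrable (by fun_prop) _ _]
    refine Finset.sum_congr rfl fun p _ => ?_
    congr 1 with θ
    ring
  have := continuous_azimuthFactor
  simp only [inner]
  simp only [← Fintype.sum_prod_type']
  rw [intervalIntegral.integral_finsetSum fun p _ =>
    Continuous.intervalIntegrable (by fun_prop) _ _]
  simp only [intervalIntegral.integral_const_mul, integral_polarFactor, integral_azimuthFactor,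
    Fintype.sum_prod_type, Fin.sum_univ_four]
  simp
  field_simp
  ring

/-- The product vector `u ⊗ v` of a pair of qubits. -/
def prodVec (u v : Fin 2 → ℂ) (p : Fin 2 × Fin 2) : ℂ := u p.1 * v p.2

/-- The operator that exchanges the two qubits of a pair. -/
def swapOp : PairOp := (1 : PairOp).submatrix Prod.swap id

theorem vecMulVec_prodVec (u v : Fin 2 → ℂ) :
    vecMulVec (prodVec u v) (star (prodVec u v)) =
      vecMulVec u (star u) ⊗ₖ vecMulVec v (star v) := by
  ext p q
  simp only [vecMulVec_apply, prodVec, Pi.star_apply, star_mul', kroneckerMap_apply]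
  ring

theorem sum_pauli_kronecker_pauli :
    ∑ μ, (pauliUnitary μ : QubitOp) ⊗ₖ (pauliUnitary μ : QubitOp) = (2 : ℂ) • swapOp := by
  ext ⟨a, b⟩ ⟨c, d⟩
  fin_cases a <;> fin_cases b <;> fin_cases c <;> fin_cases d <;>
    simp [Fin.sum_univ_four, pauliUnitary, pauliX, pauliY, pauliZ, swapOp, one_apply] <;> norm_num

theorem sum_kronecker_sum {α β : Type*} [Fintype α] [Fintype β] (A : α → QubitOp)
    (B : β → QubitOp) : (∑ μ, A μ) ⊗ₖ (∑ ν, B ν) = ∑ μ, ∑ ν, A μ ⊗ₖ B ν := by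
  ext p q
  simp only [kroneckerMap_apply, Matrix.sum_apply, Finset.sum_mul_sum]

theorem sandwich_prodVec_blochVec (A : PairOp) (θ φ : ℝ) :
    sandwich (prodVec (blochVec θ φ) (blochVec θ φ)) A =
      ∑ μ, ∑ ν, expect A ((pauliUnitary μ : QubitOp) ⊗ₖ (pauliUnitary ν : QubitOp)) / 4 *
        ((polarFactor μ θ * azimuthFactor μ φ) * (polarFactor ν θ * azimuthFactor ν φ)) := by
  have half : (1 / 2 : ℂ) = ((1 / 2 : ℝ) : ℂ) := by push_cast; rfl
  rw [← expect_vecMulVec_right, vecMulVec_prodVec, vecMulVec_blochVec, half]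
  simp only [smul_kronecker, kronecker_smul, sum_kronecker_sum, expect_smul_right,
    expect_sum_right, Finset.mul_sum]
  refine Finset.sum_congr rfl fun μ _ => Finset.sum_congr rfl fun ν _ => ?_
  ring

theorem blochAverage_sandwich_prodVec (A : PairOp) :
    blochAverage (fun ψ => sandwich (prodVec ψ ψ) A) =
      (A.trace.re + expect A swapOp) / 6 := by
  have completeness := congrArg (expect A) sum_pauli_kronecker_pauli
  have identity : expect A ((pauliUnitary 0 : QubitOp) ⊗ₖ (pauliUnitary 0 : QubitOp)) =
      A.trace.re := by
    simp [expect, pauliUnitary]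
  rw [← Complex.ofReal_ofNat, expect_smul_right, expect_sum_right, Fin.sum_univ_four,
    identity] at completeness
  simp only [blochAverage, sandwich_prodVec_blochVec, sphere_average_quadraticForm, identity]
  linarith

end BlochSphere

/-! ### Maximally entangled states -/

section MaximallyEntangled

/-- The vector `(M ⊗ 1)|φ⁺⟩`; these vectors with `M` unitary are the maximally entangled states. -/
def maxEntVec (M : QubitOp) (p : Fin 2 × Fin 2) : ℂ := ((1 / √2 : ℝ) : ℂ) * M p.1 p.2

theorem bellVec_eq_maxEntVec (j : Fin 4) : bellVec j = maxEntVec (pauliUnitary j) := rfl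

theorem inv_sqrt_two_mul_self : ((1 / √2 : ℝ) : ℂ) * ((1 / √2 : ℝ) : ℂ) = 1 / 2 := by
  rw [← Complex.ofReal_mul, div_mul_div_comm, Real.mul_self_sqrt zero_le_two]
  norm_num

theorem star_maxEntVec_dotProduct (M N : QubitOp) :
    star (maxEntVec M) ⬝ᵥ maxEntVec N = (Mᴴ * N).trace / 2 := by
  have := inv_sqrt_two_mul_self
  simp only [dotProduct, maxEntVec, Fintype.sum_prod_type, Fin.sum_univ_two, Pi.star_apply,
    star_mul', Complex.star_def, Complex.conj_ofReal, trace_fin_two, mul_apply,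
    conjTranspose_apply]
  linear_combination ((starRingEnd ℂ) (M 0 0) * N 0 0 + (starRingEnd ℂ) (M 0 1) * N 0 1 +
    (starRingEnd ℂ) (M 1 0) * N 1 0 + (starRingEnd ℂ) (M 1 1) * N 1 1) * this

theorem star_maxEntVec_dotProduct_self (U : unitaryGroup (Fin 2) ℂ) :
    star (maxEntVec U) ⬝ᵥ maxEntVec U = 1 := by
  rw [star_maxEntVec_dotProduct, ← star_eq_conjTranspose, UnitaryGroup.star_mul_self, trace_one,
    Fintype.card_fin, Nat.cast_two, div_self two_ne_zero]

theorem kronecker_mulVec_maxEntVec (A B N : QubitOp) :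
    (A ⊗ₖ B) *ᵥ maxEntVec N = maxEntVec (A * N * Bᵀ) := by
  ext p
  simp only [mulVec, dotProduct, kroneckerMap_apply, maxEntVec, Fintype.sum_prod_type,
    Fin.sum_univ_two, mul_apply, transpose_apply]
  ring

theorem bellOverlap_eq_sandwich (τ : PairOp) (U : unitaryGroup (Fin 2) ℂ) :
    bellOverlap τ U = sandwich (maxEntVec (UnitaryGroup.map_star U)) τ := by
  have conjTranspose_one_kronecker :
      ((1 : QubitOp) ⊗ₖ (U : QubitOp))ᴴ = (1 : QubitOp) ⊗ₖ (U : QubitOp)ᴴ := by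
    rw [conjTranspose_kronecker, conjTranspose_one]
  rw [bellOverlap, ← conjTranspose_one_kronecker, sandwich_mul_mul_conjTranspose,
    conjTranspose_one_kronecker, bellVec_eq_maxEntVec, kronecker_mulVec_maxEntVec]
  congr 2
  simp [pauliUnitary, conjTranspose, transpose_map]

theorem bellOverlap_map_star (τ : PairOp) (U : unitaryGroup (Fin 2) ℂ) :
    bellOverlap τ (UnitaryGroup.map_star U) = sandwich (maxEntVec U) τ := by
  rw [bellOverlap_eq_sandwich]
  congr 2
  ext a b
  exact star_star _

theorem norm_maxEntVec_le_one (U : unitaryGroup (Fin 2) ℂ) (p : Fin 2 × Fin 2) :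
    ‖maxEntVec U p‖ ≤ 1 := by
  have inv_sqrt_two_le_one : 1 / √2 ≤ (1 : ℝ) :=
    div_le_one_of_le₀ (Real.one_le_sqrt.2 one_le_two) (Real.sqrt_nonneg 2)
  rw [maxEntVec, norm_mul, Complex.norm_of_nonneg (by positivity)]
  exact mul_le_one₀ inv_sqrt_two_le_one (norm_nonneg _) (entry_norm_bound_of_unitary U.2 _ _)

theorem bddAbove_bellOverlap (τ : PairOp) : BddAbove (Set.range (bellOverlap τ)) := by
  refine ⟨∑ p, ∑ q, ‖τ p q‖, ?_⟩
  rintro _ ⟨U, rfl⟩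
  rw [bellOverlap_eq_sandwich]
  exact sandwich_le_sum_norm (norm_maxEntVec_le_one _) τ

theorem bellOverlap_le (τ : PairOp) (U : unitaryGroup (Fin 2) ℂ) :
    bellOverlap τ U ≤ fullyEntangledFraction τ :=
  le_ciSup (bddAbove_bellOverlap τ) U

end MaximallyEntangled

/-! ### The teleportation fidelity of a pair of qubits -/

section Teleportation

/-- The partial transpose of `τ` on the first qubit. -/
def partialTranspose (τ : PairOp) : PairOp := of fun p q => τ (q.1, p.2) (p.1, q.2)

theorem trace_partialTranspose (τ : PairOp) : (partialTranspose τ).trace = τ.trace := rfl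

theorem expect_partialTranspose (A B : PairOp) :
    expect (partialTranspose A) (partialTranspose B) = expect A B := by
  simp only [expect, trace, diag, mul_apply, partialTranspose, of_apply, Fintype.sum_prod_type,
    Fin.sum_univ_two]
  ring_nf

theorem kronecker_mulVec_prodVec (A B : QubitOp) (u v : Fin 2 → ℂ) :
    (A ⊗ₖ B) *ᵥ prodVec u v = prodVec (A *ᵥ u) (B *ᵥ v) := by
  ext p
  simp only [mulVec, dotProduct, kroneckerMap_apply, prodVec, Fintype.sum_prod_type,
    Fin.sum_univ_two]
  ring

theorem swapOp_mul_kronecker (A B : QubitOp) : swapOp * (A ⊗ₖ B) = (B ⊗ₖ A) * swapOp := by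
  ext ⟨a, b⟩ ⟨c, d⟩
  fin_cases c <;> fin_cases d <;>
    simp [swapOp, mul_apply, one_apply, Fintype.sum_prod_type] <;> ring

theorem swapOp_mul_kronecker_eq_partialTranspose (U : QubitOp) :
    swapOp * (Uᴴ ⊗ₖ U) = ((2 : ℝ) : ℂ) • partialTranspose
      (vecMulVec (maxEntVec (U.map star)) (star (maxEntVec (U.map star)))) := by
  ext p q
  have apply_eq : (swapOp * (Uᴴ ⊗ₖ U)) p q = star (U q.1 p.2) * U p.1 q.2 := by
    simp [swapOp, mul_apply, one_apply]
  simp only [apply_eq, Matrix.smul_apply, partialTranspose, of_apply, vecMulVec_apply, maxEntVec,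
    Pi.star_apply, star_mul', Complex.star_def, Complex.conj_ofReal, map_apply, Complex.conj_conj,
    smul_eq_mul, Complex.ofReal_ofNat]
  linear_combination (-2 * (starRingEnd ℂ) (U q.1 p.2) * U p.1 q.2) * inv_sqrt_two_mul_self

theorem sandwich_bobState (τ : PairOp) (ψ χ : Fin 2 → ℂ) (j : Fin 4) :
    sandwich χ (bobState τ ψ j) =
      sandwich (prodVec ((pauliUnitary j : QubitOp)ᴴ *ᵥ ψ) χ) (partialTranspose τ) / 2 := by
  have apply_eq : ∀ b b', bobState τ ψ j b b' = ((1 / 2 : ℝ) : ℂ) * ∑ a, ∑ a',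
      ((pauliUnitary j : QubitOp)ᴴ *ᵥ ψ) a * star (((pauliUnitary j : QubitOp)ᴴ *ᵥ ψ) a') *
        τ (a, b) (a', b') := by
    intro b b'
    rw [Complex.ofReal_div, Complex.ofReal_one, Complex.ofReal_ofNat, ← inv_sqrt_two_mul_self]
    simp only [bobState, of_apply, bellVec_eq_maxEntVec, maxEntVec, Fin.sum_univ_two, mulVec,
      dotProduct, conjTranspose_apply, star_add, star_mul', Complex.star_def,
      Complex.conj_ofReal, Complex.conj_conj]
    ring
  rw [sandwich, sandwich, eq_div_iff two_ne_zero, ← Complex.re_mul_ofReal]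
  congr 1
  simp only [dotProduct, mulVec, apply_eq, prodVec, partialTranspose, of_apply,
    Fintype.sum_prod_type, Fin.sum_univ_two, Pi.star_apply, star_mul']
  push_cast
  ring

/-- The operator whose expectation value in `ψ ⊗ ψ` is the fidelity with which `ψ` is teleported. -/
def inputFidelityOp (τ : PairOp) (V : Fin 4 → unitaryGroup (Fin 2) ℂ) : PairOp :=
  ((1 / 2 : ℝ) : ℂ) • ∑ j, ((pauliUnitary j : QubitOp) ⊗ₖ (V j : QubitOp)) * partialTranspose τ *
    ((pauliUnitary j : QubitOp) ⊗ₖ (V j : QubitOp))ᴴ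

theorem inputFidelity_eq (τ : PairOp) (V : Fin 4 → unitaryGroup (Fin 2) ℂ) (ψ : Fin 2 → ℂ) :
    inputFidelity τ V ψ = sandwich (prodVec ψ ψ) (inputFidelityOp τ V) := by
  rw [inputFidelityOp, sandwich_smul_right, sandwich_sum_right, Finset.mul_sum, inputFidelity]
  refine Finset.sum_congr rfl fun j _ => ?_
  rw [sandwich_mul_mul_conjTranspose, sandwich_bobState, sandwich_mul_mul_conjTranspose,
    conjTranspose_kronecker, kronecker_mulVec_prodVec]
  ring

theorem trace_kronecker_conj (U V : unitaryGroup (Fin 2) ℂ) (τ : PairOp) :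
    (((U : QubitOp) ⊗ₖ (V : QubitOp)) * τ * ((U : QubitOp) ⊗ₖ (V : QubitOp))ᴴ).trace =
      τ.trace := by
  have unitary := kronecker_mem_unitary U.2 V.2
  rw [trace_mul_cycle, ← star_eq_conjTranspose, mem_unitaryGroup_iff'.1 unitary, one_mul]

theorem expect_kronecker_conj_swapOp (τ : PairOp) (U V : unitaryGroup (Fin 2) ℂ) :
    expect (((U : QubitOp) ⊗ₖ (V : QubitOp)) * partialTranspose τ *
      ((U : QubitOp) ⊗ₖ (V : QubitOp))ᴴ) swapOp = 2 * bellOverlap τ (U⁻¹ * V) := by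
  have swap_conj : ((U : QubitOp) ⊗ₖ (V : QubitOp))ᴴ * swapOp * ((U : QubitOp) ⊗ₖ (V : QubitOp)) =
      swapOp * (((U⁻¹ * V : unitaryGroup (Fin 2) ℂ) : QubitOp)ᴴ ⊗ₖ
        ((U⁻¹ * V : unitaryGroup (Fin 2) ℂ) : QubitOp)) := by
    rw [conjTranspose_kronecker, ← swapOp_mul_kronecker, mul_assoc, ← mul_kronecker_mul,
      UnitaryGroup.mul_val, UnitaryGroup.inv_val, star_eq_conjTranspose, conjTranspose_mul,
      conjTranspose_conjTranspose]
  have cyclic : ∀ W : PairOp, expect (W * partialTranspose τ * Wᴴ) swapOp =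
      expect (partialTranspose τ) (Wᴴ * swapOp * W) := fun W => by
    rw [expect, expect, mul_assoc, mul_assoc, trace_mul_comm, mul_assoc]
  rw [cyclic, swap_conj, swapOp_mul_kronecker_eq_partialTranspose, expect_smul_right,
    expect_partialTranspose, expect_vecMulVec_right, bellOverlap_eq_sandwich]
  rfl

theorem fidelityWith_eq (τ : PairOp) (V : Fin 4 → unitaryGroup (Fin 2) ℂ) :
    fidelityWith τ V =
      τ.trace.re / 3 + (∑ j, bellOverlap τ ((pauliUnitary j)⁻¹ * V j)) / 6 := by
  have trace_eq : (inputFidelityOp τ V).trace.re = 2 * τ.trace.re := by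
    simp only [inputFidelityOp, trace_smul, trace_sum, trace_kronecker_conj, Finset.sum_const,
      trace_partialTranspose, Finset.card_univ, Fintype.card_fin, smul_eq_mul,
      Complex.re_ofReal_mul, nsmul_eq_mul, ← Complex.ofReal_natCast]
    push_cast
    ring
  have swap_eq : expect (inputFidelityOp τ V) swapOp =
      ∑ j, bellOverlap τ ((pauliUnitary j)⁻¹ * V j) := by
    rw [expect_comm, inputFidelityOp, expect_smul_right, expect_sum_right, Finset.mul_sum]
    refine Finset.sum_congr rfl fun j _ => ?_
    rw [expect_comm, expect_kronecker_conj_swapOp, ← mul_assoc, one_div_mul_cancel two_ne_zero,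
      one_mul]
  calc fidelityWith τ V = blochAverage (inputFidelity τ V) := rfl
    _ = blochAverage fun ψ => sandwich (prodVec ψ ψ) (inputFidelityOp τ V) :=
        congrArg blochAverage (funext (inputFidelity_eq τ V))
    _ = (2 * τ.trace.re + ∑ j, bellOverlap τ ((pauliUnitary j)⁻¹ * V j)) / 6 := by
        rw [blochAverage_sandwich_prodVec, trace_eq, swap_eq]
    _ = _ := by ring

theorem fidelityWith_pauli_mul (τ : PairOp) (U : unitaryGroup (Fin 2) ℂ) :
    fidelityWith τ (fun j => pauliUnitary j * U) = (τ.trace.re + 2 * bellOverlap τ U) / 3 := by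
  rw [fidelityWith_eq]
  simp only [inv_mul_cancel_left, Finset.sum_const, Finset.card_univ, Fintype.card_fin,
    nsmul_eq_mul]
  push_cast
  ring

theorem fidelityWith_le (τ : PairOp) (V : Fin 4 → unitaryGroup (Fin 2) ℂ) :
    fidelityWith τ V ≤ (τ.trace.re + 2 * fullyEntangledFraction τ) / 3 := by
  rw [fidelityWith_eq, Fin.sum_univ_four]
  have := fun j => bellOverlap_le τ ((pauliUnitary j)⁻¹ * V j)
  linarith [this 0, this 1, this 2, this 3]

theorem fidelityWith_le_teleportFidelity (τ : PairOp) (V : Fin 4 → unitaryGroup (Fin 2) ℂ) :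
    fidelityWith τ V ≤ teleportFidelity τ :=
  le_ciSup ⟨_, Set.forall_mem_range.2 (fidelityWith_le τ)⟩ V

theorem teleportFidelity_eq (τ : PairOp) :
    teleportFidelity τ = (τ.trace.re + 2 * fullyEntangledFraction τ) / 3 := by
  refine le_antisymm (ciSup_le (fidelityWith_le τ)) ?_
  have fraction_le : fullyEntangledFraction τ ≤ (3 * teleportFidelity τ - τ.trace.re) / 2 :=
    ciSup_le fun U => by
      linarith [fidelityWith_pauli_mul τ U,
        fidelityWith_le_teleportFidelity τ fun j => pauliUnitary j * U]
  linarith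

end Teleportation

/-! ### Graph states and their stabilizers -/

section GraphStates

open scoped Fin.CommRing

/-- The sign `(-1) ^ a`, as a character of the additive group of bits. -/
def bitSign : AddChar (Fin 2) ℝ where
  toFun a := (-1) ^ (a : ℕ)
  map_zero_eq_one' := pow_zero _
  map_add_eq_mul' a b := by fin_cases a <;> fin_cases b <;> simp

theorem bitSign_apply (a : Fin 2) : bitSign a = (-1) ^ (a : ℕ) := rfl

theorem bitSign_one : bitSign 1 = -1 := pow_one _

theorem bitSign_sum {ι : Type*} (s : Finset ι) (f : ι → Fin 2) :
    bitSign (∑ i ∈ s, f i) = ∏ i ∈ s, bitSign (f i) :=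
  map_sum bitSign.toAddMonoidHom f s

theorem bitSign_mul_self (a : Fin 2) : bitSign a * bitSign a = 1 := by
  rw [bitSign_apply, ← mul_pow, neg_one_mul, neg_neg, one_pow]

variable {n : ℕ}

theorem sum_bitSign_dotProduct (u : Fin n → Fin 2) :
    ∑ x, bitSign (u ⬝ᵥ x) = if u = 0 then 2 ^ n else 0 := by
  have sum_bit : ∀ a : Fin 2, ∑ b, bitSign (a * b) = if a = 0 then 2 else 0 := fun a => by
    fin_cases a <;> norm_num [Fin.sum_univ_two, bitSign_one]
  simp only [dotProduct, bitSign_sum]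
  rw [← Fintype.prod_sum fun i a => bitSign (u i * a)]
  simp only [sum_bit, Fintype.prod_ite_zero, Finset.prod_const, Finset.card_univ, Fintype.card_fin,
    funext_iff, Pi.zero_apply]

variable (n) in
/-- The matrix of the quadratic form in the phase of the linear cluster state: it has an entry `1`
for each controlled-`Z` gate. -/
def pathMatrix : Matrix (Fin n) (Fin n) (Fin 2) :=
  of fun i j => if (i : ℕ) + 1 = (j : ℕ) then 1 else 0

theorem clusterVec_eq (x : Fin n → Fin 2) :
    clusterVec n x = ((1 / √2 : ℝ) : ℂ) ^ n * (bitSign (x ⬝ᵥ pathMatrix n *ᵥ x) : ℂ) := by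
  have factor : ∀ i j : Fin n, (if (i : ℕ) + 1 = (j : ℕ) ∧ x i = 1 ∧ x j = 1 then (-1 : ℂ) else 1) =
      (bitSign (x i * (pathMatrix n i j * x j)) : ℂ) := by
    intro i j
    rcases (by decide : ∀ a : Fin 2, a = 0 ∨ a = 1) (x i) with hi | hi <;>
      rcases (by decide : ∀ a : Fin 2, a = 0 ∨ a = 1) (x j) with hj | hj <;>
      by_cases hij : (i : ℕ) + 1 = (j : ℕ) <;> simp [hi, hj, hij, pathMatrix, bitSign_one]
  simp only [clusterVec, factor, dotProduct, mulVec, Finset.mul_sum, bitSign_sum,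
    Complex.ofReal_prod]

theorem star_clusterVec (x : Fin n → Fin 2) : star (clusterVec n x) = clusterVec n x := by
  rw [clusterVec_eq, ← Complex.ofReal_pow, ← Complex.ofReal_mul, Complex.star_def,
    Complex.conj_ofReal]

theorem clusterVec_mul_self (x : Fin n → Fin 2) :
    clusterVec n x * clusterVec n x = (1 / 2) ^ n := by
  rw [clusterVec_eq, mul_mul_mul_comm, ← mul_pow, inv_sqrt_two_mul_self, ← Complex.ofReal_mul,
    bitSign_mul_self, Complex.ofReal_one, mul_one]

theorem clusterVec_add_single (i : Fin n) (x : Fin n → Fin 2) :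
    clusterVec n (x + Pi.single i 1) =
      bitSign (((pathMatrix n + (pathMatrix n)ᵀ) *ᵥ x) i) * clusterVec n x := by
  have quadratic : (x + Pi.single i 1) ⬝ᵥ pathMatrix n *ᵥ (x + Pi.single i 1) =
      ((pathMatrix n + (pathMatrix n)ᵀ) *ᵥ x) i + x ⬝ᵥ pathMatrix n *ᵥ x := by
    have loopless : pathMatrix n i i = 0 := by simp [pathMatrix]
    rw [mulVec_add, dotProduct_add, add_dotProduct, add_dotProduct,
      dotProduct_mulVec x _ (Pi.single i 1), dotProduct_single_one, single_one_dotProduct,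
      single_one_dotProduct, mulVec_single_one, add_mulVec, Pi.add_apply, mulVec_transpose,
      col_apply, loopless]
    ring
  rw [clusterVec_eq, clusterVec_eq, quadratic, AddChar.map_add_eq_mul]
  push_cast
  ring

/-- The vector `Z ^ w |Cₙ⟩` of the graph basis. -/
def graphVec (w x : Fin n → Fin 2) : ℂ := bitSign (w ⬝ᵥ x) * clusterVec n x

theorem graphVec_zero : graphVec (0 : Fin n → Fin 2) = clusterVec n := by
  ext x
  rw [graphVec, zero_dotProduct, AddChar.map_zero_eq_one, Complex.ofReal_one, one_mul]

theorem star_graphVec_dotProduct (w w' : Fin n → Fin 2) :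
    star (graphVec w) ⬝ᵥ graphVec w' = if w = w' then 1 else 0 := by
  have eq_iff : w + w' = 0 ↔ w = w' := by
    simp only [funext_iff, Pi.add_apply, Pi.zero_apply]
    exact forall_congr' fun i => by generalize w i = a; generalize w' i = b; revert a b; decide
  calc star (graphVec w) ⬝ᵥ graphVec w' = (∑ x, bitSign ((w + w') ⬝ᵥ x) : ℝ) * (1 / 2) ^ n := by
        rw [Complex.ofReal_sum, Finset.sum_mul]
        refine Finset.sum_congr rfl fun x _ => ?_
        rw [← clusterVec_mul_self x, Pi.star_apply, graphVec, graphVec, star_mul',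
          star_clusterVec, Complex.star_def, Complex.conj_ofReal, add_dotProduct,
          AddChar.map_add_eq_mul]
        push_cast
        ring
    _ = if w = w' then 1 else 0 := by
        rw [sum_bitSign_dotProduct]
        simp only [eq_iff]
        split_ifs <;> simp

theorem sum_graphProj : ∑ w : Fin n → Fin 2, vecMulVec (graphVec w) (star (graphVec w)) = 1 := by
  set G : Op n := of fun x w => graphVec w x
  have isometry : Gᴴ * G = 1 := by
    ext w w'
    rw [mul_apply', one_apply, ← star_graphVec_dotProduct]
    rfl
  rw [← mul_eq_one_comm.1 isometry]
  ext x y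
  simp only [Matrix.sum_apply, vecMulVec_apply, mul_apply]
  rfl

theorem tensor_mulVec_apply {A : Fin n → QubitOp} {f : Fin n → Fin 2 → ℂ} {d : Fin n → Fin 2}
    (hA : ∀ j a b, A j a b = if b = a + d j then f j a else 0) (v : (Fin n → Fin 2) → ℂ)
    (x : Fin n → Fin 2) : (tensor A *ᵥ v) x = (∏ j, f j (x j)) * v (x + d) := by
  have apply_eq : ∀ y, tensor A x y = if y = x + d then ∏ j, f j (x j) else 0 := fun y => by
    rw [tensor, of_apply, Finset.prod_congr rfl fun j _ => hA j _ _, Fintype.prod_ite_zero]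
    simp only [funext_iff, Pi.add_apply]
    split_ifs <;> rfl
  simp only [mulVec, dotProduct, apply_eq, ite_mul, zero_mul, Finset.sum_ite_eq',
    Finset.mem_univ, if_true]

theorem pauliX_apply (a b : Fin 2) : pauliX a b = if b = a + 1 then 1 else 0 := by
  fin_cases a <;> fin_cases b <;> simp [pauliX]

theorem pauliZ_apply (a b : Fin 2) : pauliZ a b = if b = a then (bitSign a : ℂ) else 0 := by
  fin_cases a <;> fin_cases b <;> simp [pauliZ, bitSign_one]

theorem opZ_mulVec_apply (i : Fin n) (v : (Fin n → Fin 2) → ℂ) (x : Fin n → Fin 2) :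
    (opZ i *ᵥ v) x = bitSign (x i) * v x := by
  rw [opZ, tensor_mulVec_apply (f := fun j a => if j = i then (bitSign a : ℂ) else 1) (d := 0),
    add_zero, Finset.prod_ite_eq' Finset.univ i, if_pos (Finset.mem_univ i)]
  intro j a b
  split_ifs <;> simp_all [pauliZ_apply, one_apply, eq_comm]

theorem gen_mulVec_apply (i : Fin n) (v : (Fin n → Fin 2) → ℂ) (x : Fin n → Fin 2) :
    (gen i *ᵥ v) x = bitSign (((pathMatrix n + (pathMatrix n)ᵀ) *ᵥ x) i) *
      v (x + Pi.single i 1) := by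
  have neighbours : bitSign (((pathMatrix n + (pathMatrix n)ᵀ) *ᵥ x) i) =
      ∏ j : Fin n, if (j : ℕ) + 1 = (i : ℕ) ∨ (i : ℕ) + 1 = (j : ℕ) then bitSign (x j) else 1 := by
    rw [mulVec, dotProduct, bitSign_sum]
    refine Finset.prod_congr rfl fun j _ => ?_
    simp only [pathMatrix, Matrix.add_apply, of_apply, transpose_apply]
    split_ifs <;> first | omega | simp
  rw [gen, tensor_mulVec_apply (f := fun j a => if (j : ℕ) + 1 = (i : ℕ) ∨ (i : ℕ) + 1 = (j : ℕ)
    then (bitSign a : ℂ) else 1) (d := Pi.single i 1), neighbours]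
  · simp [apply_ite]
  · intro j a b
    rcases eq_or_ne j i with rfl | hj
    · simp [pauliX_apply]
    · split_ifs <;> simp_all [pauliZ_apply, one_apply, eq_comm]

theorem gen_mulVec_graphVec (i : Fin n) (w : Fin n → Fin 2) :
    gen i *ᵥ graphVec w = (bitSign (w i) : ℂ) • graphVec w := by
  ext x
  rw [gen_mulVec_apply, graphVec, dotProduct_add, dotProduct_single_one, clusterVec_add_single,
    AddChar.map_add_eq_mul, Pi.smul_apply, graphVec, smul_eq_mul]
  have square := congrArg Complex.ofReal
    (bitSign_mul_self (((pathMatrix n + (pathMatrix n)ᵀ) *ᵥ x) i))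
  push_cast at square ⊢
  linear_combination (bitSign (w ⬝ᵥ x) * bitSign (w i) * clusterVec n x : ℂ) * square

theorem opZ_mulVec_clusterVec (i : Fin n) : opZ i *ᵥ clusterVec n = graphVec (Pi.single i 1) := by
  ext x
  rw [opZ_mulVec_apply, graphVec, single_one_dotProduct]

theorem conjTranspose_opZ (i : Fin n) : (opZ i)ᴴ = opZ i := by
  have entry : ∀ (A : QubitOp) (a b : Fin 2), (A = pauliZ ∨ A = 1) → star (A b a) = A a b := by
    rintro A a b (rfl | rfl) <;> fin_cases a <;> fin_cases b <;> simp [pauliZ]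
  ext x y
  rw [conjTranspose_apply, opZ, tensor, of_apply, of_apply, star_prod]
  exact Finset.prod_congr rfl fun j _ => entry _ _ _ (ite_eq_or_eq _ _ _)

theorem opZ_mul_clusterProj_mul_opZ (i : Fin n) : opZ i * clusterProj n * opZ i =
    vecMulVec (graphVec (Pi.single i 1)) (star (graphVec (Pi.single i 1))) := by
  rw [clusterProj, mul_vecMulVec, vecMulVec_mul, ← opZ_mulVec_clusterVec, star_mulVec,
    conjTranspose_opZ]

theorem sum_sandwich_graphVec (ρ : Op n) : ∑ w, sandwich (graphVec w) ρ = ρ.trace.re := by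
  simp only [← expect_vecMulVec_right]
  rw [← expect_sum_right, sum_graphProj, expect, mul_one]

theorem expect_gen (i : Fin n) (ρ : Op n) :
    expect (gen i) ρ = ∑ w, bitSign (w i) * sandwich (graphVec w) ρ := by
  rw [expect_comm, ← mul_one (gen i), ← sum_graphProj, Finset.mul_sum, expect_sum_right]
  refine Finset.sum_congr rfl fun w _ => ?_
  rw [mul_vecMulVec, gen_mulVec_graphVec, smul_vecMulVec, expect_smul_right,
    expect_vecMulVec_right]

theorem sum_bitSign_le (w : Fin n → Fin 2) :
    ∑ i, bitSign (w i) ≤ n - 2 + if w = 0 then 2 else 0 := by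
  have bitSign_le_one : ∀ a, bitSign a ≤ 1 := fun a => by
    fin_cases a <;> norm_num [bitSign_one]
  split_ifs with hw
  · refine (Finset.sum_le_card_nsmul _ _ 1 fun i _ => bitSign_le_one (w i)).trans ?_
    simp
  · obtain ⟨j, hj⟩ := Function.ne_iff.1 hw
    have flipped : bitSign (w j) = -1 := by
      rw [Fin.eq_one_of_ne_zero _ hj, bitSign_one]
    have others := Finset.sum_le_card_nsmul (Finset.univ.erase j) _ 1
      fun i _ => bitSign_le_one (w i)
    rw [← Finset.add_sum_erase _ _ (Finset.mem_univ j), flipped]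
    rw [Finset.card_erase_of_mem (Finset.mem_univ j), Finset.card_univ, Fintype.card_fin,
      nsmul_eq_mul, mul_one, Nat.cast_pred j.pos] at others
    linarith

theorem wcWeight_le_sandwich_clusterVec {c : ℝ} {ρ : Op n} (hρ : IsState ρ)
    (h : ∀ i, c ≤ expect (gen i) ρ) : wcWeight n c ≤ sandwich (clusterVec n) ρ := by
  have trace_eq : ∑ w : Fin n → Fin 2, sandwich (graphVec w) ρ = 1 := by
    rw [sum_sandwich_graphVec, hρ.2, Complex.one_re]
  have bound := calc
    n * c ≤ ∑ i, expect (gen i) ρ := by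
      simpa using Finset.card_nsmul_le_sum Finset.univ (fun i => expect (gen i) ρ) c fun i _ => h i
    _ = ∑ w, (∑ i, bitSign (w i)) * sandwich (graphVec w) ρ := by
      simp only [expect_gen, Finset.sum_mul]
      exact Finset.sum_comm
    _ ≤ ∑ w : Fin n → Fin 2, (n - 2 + if w = 0 then 2 else 0) * sandwich (graphVec w) ρ :=
      Finset.sum_le_sum fun w _ =>
        mul_le_mul_of_nonneg_right (sum_bitSign_le w) (sandwich_nonneg hρ.1 _)
    _ = n - 2 + 2 * sandwich (clusterVec n) ρ := by
      simp only [add_mul, Finset.sum_add_distrib, ← Finset.mul_sum, trace_eq, mul_one, ite_mul,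
        zero_mul, Finset.sum_ite_eq', Finset.mem_univ, if_true, graphVec_zero]
  rw [wcWeight]
  linarith

/-! ### The worst-case state -/

theorem wcState_eq_mixture (c : ℝ) : wcState n c =
    mixture (wcWeight n c) (graphVec 0) fun i : Fin n => graphVec (Pi.single i 1) := by
  simp only [wcState, opZ_mul_clusterProj_mul_opZ]
  rw [mixture, Fintype.card_fin, graphVec_zero, clusterProj]

theorem star_graphVec_dotProduct_self (w : Fin n → Fin 2) :
    star (graphVec w) ⬝ᵥ graphVec w = 1 := by
  rw [star_graphVec_dotProduct, if_pos rfl]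

theorem isState_wcState [NeZero n] {c : ℝ} (h0 : 0 ≤ wcWeight n c) (h1 : wcWeight n c ≤ 1) :
    IsState (wcState n c) := by
  rw [wcState_eq_mixture]
  exact isState_mixture h0 h1 (star_graphVec_dotProduct_self _)
    fun i => star_graphVec_dotProduct_self _

theorem sandwich_graphVec_gen (i : Fin n) (w : Fin n → Fin 2) :
    sandwich (graphVec w) (gen i) = bitSign (w i) := by
  rw [sandwich, gen_mulVec_graphVec, dotProduct_smul, star_graphVec_dotProduct_self, smul_eq_mul,
    mul_one, Complex.ofReal_re]

theorem sum_bitSign_single (i : Fin n) :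
    ∑ j, bitSign ((Pi.single j 1 : Fin n → Fin 2) i) = n - 2 := by
  have apply_eq : ∀ j, bitSign ((Pi.single j 1 : Fin n → Fin 2) i) =
      1 - if i = j then 2 else 0 := fun j => by
    rw [Pi.single_apply]
    split_ifs <;> norm_num [bitSign_one]
  simp only [apply_eq, Finset.sum_sub_distrib]
  simp

theorem expect_gen_wcState (c : ℝ) (i : Fin n) : expect (gen i) (wcState n c) = c := by
  have n_ne_zero : (n : ℝ) ≠ 0 := Nat.cast_ne_zero.2 i.pos.ne'
  rw [wcState_eq_mixture, expect_mixture, sandwich_graphVec_gen]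
  simp only [sandwich_graphVec_gen, sum_bitSign_single, wcWeight, Pi.zero_apply,
    AddChar.map_zero_eq_one, Fintype.card_fin]
  field_simp
  ring

end GraphStates

/-! ### Measuring the inner qubits -/

section Frame

variable {α : Type} {k : ℕ} (a : α) (z : Fin k → α) (b : α)

@[simp] theorem frame_zero : frame a z b 0 = a := rfl

@[simp] theorem frame_last : frame a z b (Fin.last (k + 1)) = b := by
  rw [frame, ← Fin.succ_last, Fin.cons_succ, Fin.snoc_last]

@[simp] theorem frame_inner (i : Fin k) : frame a z b i.castSucc.succ = z i := by
  rw [frame, Fin.cons_succ, Fin.snoc_castSucc]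

theorem forall_frame {p : Fin (k + 2) → Prop} (zero : p 0)
    (inner : ∀ i : Fin k, p i.castSucc.succ) (last : p (Fin.last (k + 1))) : ∀ j, p j :=
  Fin.cases zero (Fin.lastCases last inner)

theorem frame_const : frame a (fun _ : Fin k => a) a = fun _ => a :=
  funext <| forall_frame rfl (frame_inner a _ a) (frame_last a _ a)

theorem prod_frame {M : Type*} [CommMonoid M] (F : Fin (k + 2) → M) :
    ∏ j, F j = F 0 * ((∏ i : Fin k, F i.castSucc.succ) * F (Fin.last (k + 1))) := by
  rw [Fin.prod_univ_succ, Fin.prod_univ_castSucc, Fin.succ_last]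

end Frame

theorem tensor_one {n : ℕ} : tensor (fun _ : Fin n => 1) = 1 := by
  ext x y
  simp only [tensor, of_apply, one_apply, Fintype.prod_ite_zero, Finset.prod_const_one, funext_iff]

theorem tensor_frame_apply {k : ℕ} (A : QubitOp) (P : Fin k → QubitOp) (B : QubitOp)
    (x y : Fin (k + 2) → Fin 2) :
    tensor (frame A P B) x y = A (x 0) (y 0) *
      ((∏ i, P i (x i.castSucc.succ) (y i.castSucc.succ)) *
        B (x (Fin.last (k + 1))) (y (Fin.last (k + 1)))) := by
  simp only [tensor, of_apply, prod_frame, frame_zero, frame_inner, frame_last]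

theorem sum_tensor_frame {k : ℕ} (A : QubitOp) (P : Fin k → Fin 2 → QubitOp) (B : QubitOp) :
    ∑ s : Fin k → Fin 2, tensor (frame A (fun i => P i (s i)) B) =
      tensor (frame A (fun i => ∑ a, P i a) B) := by
  ext x y
  simp only [Matrix.sum_apply, tensor_frame_apply, Fintype.prod_sum, ← Finset.mul_sum,
    ← Finset.sum_mul]

theorem sum_outcomeProj (b : MeasBasis) : ∑ s, outcomeProj b s = 1 := by
  rw [Fin.sum_univ_two, outcomeProj, outcomeProj, ← smul_add, Fin.val_zero, Fin.val_one, pow_zero,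
    pow_one]
  module

/-- The entries, of modulus one, of the eigenvector of the observable `b` for outcome
`(-1) ^ s`. -/
def measPhase (b : MeasBasis) (s : Fin 2) : Fin 2 → ℂ :=
  ![1, (-1) ^ (s : ℕ) * match b with | .X => 1 | .Y => Complex.I]

theorem star_measPhase_mul (b : MeasBasis) (s x : Fin 2) :
    star (measPhase b s x) * measPhase b s x = 1 := by
  cases b <;> fin_cases s <;> fin_cases x <;> simp [measPhase]

theorem outcomeProj_apply (b : MeasBasis) (s x y : Fin 2) :
    outcomeProj b s x y = 1 / 2 * (measPhase b s x * star (measPhase b s y)) := by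
  cases b <;> fin_cases s <;> fin_cases x <;> fin_cases y <;>
    simp [measPhase, outcomeProj, MeasBasis.obs, pauliX, pauliY]

section Embed

variable {k : ℕ} (m : Fin k → MeasBasis) (s : Fin k → Fin 2)

/-- The isometry from the outer pair of qubits to the line that puts the inner qubits into the
eigenstate belonging to the outcome string `s`. -/
def embed : Matrix (Fin (k + 2) → Fin 2) (Fin 2 × Fin 2) ℂ :=
  of fun x p => if p = (x 0, x (Fin.last (k + 1))) then
    ((1 / √2 : ℝ) : ℂ) ^ k * ∏ i, measPhase (m i) (s i) (x i.castSucc.succ) else 0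

theorem inv_sqrt_two_pow_mul_star (k : ℕ) :
    ((1 / √2 : ℝ) : ℂ) ^ k * star (((1 / √2 : ℝ) : ℂ) ^ k) = (1 / 2) ^ k := by
  rw [star_pow, Complex.star_def, Complex.conj_ofReal, ← mul_pow, inv_sqrt_two_mul_self]

theorem embed_mul_conjTranspose : embed m s * (embed m s)ᴴ = measProj m s := by
  ext x y
  rw [measProj, tensor_frame_apply, mul_apply]
  simp only [embed, conjTranspose_apply, of_apply, ite_mul, zero_mul, Finset.sum_ite_eq',
    Finset.mem_univ, if_true, outcomeProj_apply, Finset.prod_mul_distrib, Finset.prod_const,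
    Finset.card_univ, Fintype.card_fin, one_apply, Prod.mk.injEq, apply_ite star, star_zero,
    star_mul', star_prod, ← inv_sqrt_two_pow_mul_star]
  split_ifs <;> first | ring1 | simp_all

theorem traceInner_embed (N : PairOp) : traceInner (embed m s * N * (embed m s)ᴴ) = N := by
  have embed_frame : ∀ (z : Fin k → Fin 2) (p q : Fin 2 × Fin 2),
      embed m s (frame p.1 z p.2) q =
        if q = p then ((1 / √2 : ℝ) : ℂ) ^ k * ∏ i, measPhase (m i) (s i) (z i) else 0 :=
    fun z p q => by simp only [embed, of_apply, frame_zero, frame_inner, frame_last]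
  have unit_modulus : ∀ z : Fin k → Fin 2, (∏ i, measPhase (m i) (s i) (z i)) *
      star (∏ i, measPhase (m i) (s i) (z i)) = 1 := fun z => by
    rw [star_prod, ← Finset.prod_mul_distrib]
    exact Finset.prod_eq_one fun i _ => by rw [mul_comm, star_measPhase_mul]
  ext p q
  calc traceInner (embed m s * N * (embed m s)ᴴ) p q
      = ∑ z : Fin k → Fin 2, ((1 / √2 : ℝ) : ℂ) ^ k * star (((1 / √2 : ℝ) : ℂ) ^ k) *
          ((∏ i, measPhase (m i) (s i) (z i)) * star (∏ i, measPhase (m i) (s i) (z i))) *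
          N p q := by
        rw [traceInner, of_apply]
        refine Finset.sum_congr rfl fun z _ => ?_
        simp only [mul_apply, conjTranspose_apply, embed_frame, ite_mul, zero_mul,
          Finset.sum_ite_eq', Finset.mem_univ, if_true, apply_ite star, star_zero, mul_ite,
          mul_zero, star_mul']
        ring
    _ = N p q := by
        simp only [unit_modulus, inv_sqrt_two_pow_mul_star, mul_one, Finset.sum_const,
          Finset.card_univ, Fintype.card_fun, Fintype.card_fin, nsmul_eq_mul]
        rw [← mul_assoc, Nat.cast_pow, ← mul_pow]
        norm_num

theorem sum_measProj : ∑ s, measProj m s = 1 := by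
  simp only [measProj, sum_tensor_frame, sum_outcomeProj, frame_const, tensor_one]

/-- The unnormalized state of the outer pair of qubits after the outcome string `s`. -/
def outerState (ρ : Op (k + 2)) : PairOp := (embed m s)ᴴ * ρ * embed m s

theorem outcomeProb_eq (ρ : Op (k + 2)) : outcomeProb m ρ s = (outerState m s ρ).trace.re := by
  rw [outcomeProb, expect, ← embed_mul_conjTranspose, outerState, Matrix.mul_assoc,
    trace_mul_comm]

theorem postState_eq (ρ : Op (k + 2)) :
    postState m ρ s = ((outcomeProb m ρ s : ℂ))⁻¹ • outerState m s ρ := by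
  rw [postState, ← traceInner_embed m s (outerState m s ρ), outerState,
    ← embed_mul_conjTranspose]
  simp only [Matrix.mul_assoc]

theorem posSemidef_outerState {ρ : Op (k + 2)} (hρ : ρ.PosSemidef) :
    (outerState m s ρ).PosSemidef :=
  hρ.conjTranspose_mul_mul_same _

theorem sandwich_outerState (v : Fin 2 × Fin 2 → ℂ) (ρ : Op (k + 2)) :
    sandwich v (outerState m s ρ) = sandwich (embed m s *ᵥ v) ρ := by
  have := sandwich_mul_mul_conjTranspose v (embed m s)ᴴ ρ
  rwa [conjTranspose_conjTranspose] at this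

theorem sum_outcomeProb (ρ : Op (k + 2)) : ∑ s, outcomeProb m ρ s = ρ.trace.re := by
  simp only [outcomeProb, expect_comm _ ρ]
  rw [← expect_sum_right, sum_measProj, expect, mul_one]

theorem outcomeProb_nonneg {ρ : Op (k + 2)} (hρ : ρ.PosSemidef) : 0 ≤ outcomeProb m ρ s := by
  rw [outcomeProb_eq]
  exact (Complex.le_def.1 (posSemidef_outerState m s hρ).trace_nonneg).1

theorem sum_embed_mulVec (v : (Fin (k + 2) → Fin 2) → ℂ) :
    ∑ s, embed m s *ᵥ ((embed m s)ᴴ *ᵥ v) = v := by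
  simp only [mulVec_mulVec, embed_mul_conjTranspose]
  rw [← sum_mulVec, sum_measProj, one_mulVec]

end Embed

/-! ### The cluster state as a matrix product -/

section Chain

variable {G : Type*} [Group G]

/-- The product `D₀ h D₁ h ⋯ h Dₖ`. -/
def chain (h : G) : (k : ℕ) → (Fin (k + 1) → G) → G
  | 0, D => D 0
  | k + 1, D => D 0 * (h * chain h k (Fin.tail D))

theorem isConj_inv_chain_mul_chain_update (h z : G) {k : ℕ} (D : Fin (k + 1) → G)
    (i : Fin (k + 1)) :
    IsConj z ((chain h k D)⁻¹ * chain h k (Function.update D i (D i * z))) := by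
  induction k with
  | zero =>
    obtain rfl : i = 0 := Fin.eq_zero i
    rw [chain, chain, Function.update_self, inv_mul_cancel_left]
  | succ k ih =>
    induction i using Fin.cases with
    | zero =>
      rw [chain, chain, Fin.tail_update_zero, Function.update_self]
      refine isConj_iff.2 ⟨(h * chain h k (Fin.tail D))⁻¹, ?_⟩
      group
    | succ i =>
      rw [chain, chain, Fin.tail_update_succ, Function.update_of_ne (Fin.succ_ne_zero i).symm]
      convert ih (Fin.tail D) i using 1
      simp only [Fin.tail]
      group

end Chain

/-- The Hadamard gate. -/
def hadamard : unitaryGroup (Fin 2) ℂ :=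
  ⟨of fun a b => ((1 / √2 : ℝ) : ℂ) * if a = 1 ∧ b = 1 then -1 else 1, by
    have half := inv_sqrt_two_mul_self
    rw [mem_unitaryGroup_iff]
    ext a b
    simp only [mul_apply, star_apply, of_apply, star_mul', Complex.star_def, Complex.conj_ofReal,
      Fin.sum_univ_two]
    generalize ((1 / √2 : ℝ) : ℂ) = r at half
    fin_cases a <;> fin_cases b <;> simp <;> linear_combination 2 * half⟩

theorem hadamard_apply (a b : Fin 2) :
    (hadamard : QubitOp) a b = ((1 / √2 : ℝ) : ℂ) * if a = 1 ∧ b = 1 then -1 else 1 := rfl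

theorem clusterVec_cons {n : ℕ} (a : Fin 2) (y : Fin (n + 1) → Fin 2) :
    clusterVec (n + 2) (Fin.cons a y : Fin (n + 2) → Fin 2) =
      (hadamard : QubitOp) a (y 0) * clusterVec (n + 1) y := by
  have first_gate : ∏ j : Fin (n + 1), (if 0 = (j : ℕ) ∧ a = 1 ∧ y j = 1 then (-1 : ℂ) else 1) =
      if a = 1 ∧ y 0 = 1 then -1 else 1 := by
    rw [Fin.prod_univ_succ]
    simp
  rw [clusterVec, clusterVec, hadamard_apply, ← first_gate, Fin.prod_univ_succ,
    Fin.prod_univ_succ (n := n + 1)]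
  simp only [Fin.prod_univ_succ (n := n + 1), Fin.cons_zero, Fin.cons_succ, Fin.val_succ,
    Fin.val_zero, Nat.add_right_cancel_iff, Nat.succ_ne_zero, false_and, if_false]
  simp [eq_comm (a := (0 : ℕ))]
  ring

theorem sum_prod_mul_clusterVec {k : ℕ} {D : Fin (k + 1) → unitaryGroup (Fin 2) ℂ}
    {d : Fin (k + 1) → Fin 2 → ℂ} (hD : ∀ j, (D j : QubitOp) = diagonal (d j))
    (p : Fin 2 × Fin 2) :
    ∑ x : Fin (k + 1) → Fin 2, (if p = (x 0, x (Fin.last k)) then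
        (∏ j, d j (x j)) * clusterVec (k + 1) x else 0) =
      maxEntVec (chain hadamard k D : unitaryGroup (Fin 2) ℂ) p := by
  obtain ⟨a, b⟩ := p
  induction k generalizing a with
  | zero =>
    rw [← (Equiv.funUnique (Fin 1) (Fin 2)).symm.sum_comp]
    simp only [chain, maxEntVec, hD, diagonal_apply]
    fin_cases a <;> fin_cases b <;> simp [clusterVec, mul_comm]
  | succ k ih =>
    have sum_cons : ∀ f : (Fin (k + 2) → Fin 2) → ℂ, ∑ x, f x = ∑ y, ∑ c, f (Fin.cons c y) :=
      fun f => by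
        rw [← (Fin.consEquiv fun _ => Fin 2).sum_comp, Fintype.sum_prod_type_right]
        rfl
    rw [sum_cons]
    calc _ = ∑ y : Fin (k + 1) → Fin 2, ∑ c, (d 0 a * (hadamard : QubitOp) a c) *
          (if (c, b) = (y 0, y (Fin.last k)) then
            (∏ j, Fin.tail d j (y j)) * clusterVec (k + 1) y else 0) := by
          refine Finset.sum_congr rfl fun y _ => ?_
          simp only [Fin.cons_zero, ← Fin.succ_last, Fin.cons_succ, clusterVec_cons,
            Fin.prod_univ_succ (n := k + 1), Fin.tail, Prod.mk.injEq, ite_and, mul_ite, mul_zero,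
            Finset.sum_ite_eq, Finset.sum_ite_eq', Finset.mem_univ, if_true]
          split_ifs <;> ring
      _ = ∑ c, (d 0 a * (hadamard : QubitOp) a c) *
          maxEntVec (chain hadamard k (Fin.tail D) : unitaryGroup (Fin 2) ℂ) (c, b) := by
          rw [Finset.sum_comm]
          simp only [← ih (D := Fin.tail D) (d := Fin.tail d) fun j => hD j.succ, Finset.mul_sum]
      _ = maxEntVec (chain hadamard (k + 1) D : unitaryGroup (Fin 2) ℂ) (a, b) := by
          rw [chain, maxEntVec, UnitaryGroup.mul_val, UnitaryGroup.mul_val, hD, diagonal_mul,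
            mul_apply, Finset.mul_sum, Finset.mul_sum]
          refine Finset.sum_congr rfl fun c _ => ?_
          rw [maxEntVec]
          ring

section Outer

variable {k : ℕ} (m : Fin k → MeasBasis) (s : Fin k → Fin 2)

/-- The phase gate that absorbs the measurement of one inner qubit, with outcome `(-1) ^ s`, in the
matrix product. -/
def measGate (b : MeasBasis) (s : Fin 2) : unitaryGroup (Fin 2) ℂ :=
  ⟨diagonal (star (measPhase b s)), by
    rw [mem_unitaryGroup_iff, star_eq_conjTranspose, diagonal_conjTranspose, star_star,
      diagonal_mul_diagonal, diagonal_eq_one]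
    exact funext (star_measPhase_mul b s)⟩

/-- The gate at site `j` of the matrix product for the outcome string `s` and the graph basis state
`w`. -/
def siteGate (w : Fin (k + 2) → Fin 2) (j : Fin (k + 2)) : unitaryGroup (Fin 2) ℂ :=
  frame 1 (fun i => measGate (m i) (s i)) 1 j * pauliUnitary 3 ^ (w j : ℕ)

open scoped Fin.CommRing in
theorem coe_siteGate (w : Fin (k + 2) → Fin 2) (j : Fin (k + 2)) :
    (siteGate m s w j : QubitOp) = diagonal fun a =>
      frame 1 (fun i => star (measPhase (m i) (s i))) 1 j a * (bitSign (w j * a) : ℂ) := by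
  have measured : ∀ j, ((frame 1 (fun i => measGate (m i) (s i)) 1 j :
      unitaryGroup (Fin 2) ℂ) : QubitOp) =
        diagonal (frame 1 (fun i => star (measPhase (m i) (s i))) 1 j) := by
    refine forall_frame ?_ (fun i => ?_) ?_
    · rw [frame_zero, frame_zero, UnitaryGroup.one_val, diagonal_one']
    · rw [frame_inner, frame_inner, measGate]
    · rw [frame_last, frame_last, UnitaryGroup.one_val, diagonal_one']
  have flipped : ∀ b : Fin 2, ((pauliUnitary 3 ^ (b : ℕ) : unitaryGroup (Fin 2) ℂ) : QubitOp) =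
      diagonal fun a => (bitSign (b * a) : ℂ) := fun b => by
    fin_cases b <;> ext x y <;> fin_cases x <;> fin_cases y <;>
      simp [pauliUnitary, pauliZ, bitSign_one]
  rw [siteGate, UnitaryGroup.mul_val, measured, flipped, diagonal_mul_diagonal]

theorem siteGate_single (i : Fin (k + 2)) :
    siteGate m s (Pi.single i 1) =
      Function.update (siteGate m s 0) i (siteGate m s 0 i * pauliUnitary 3) := by
  ext1 j
  rcases eq_or_ne j i with rfl | hj
  · simp [siteGate]
  · simp [siteGate, hj]

/-- The unitary whose maximally entangled state is the state of the outer pair of qubits after the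
outcome string `s` for the graph basis state `w`. -/
def outerUnitary (w : Fin (k + 2) → Fin 2) : unitaryGroup (Fin 2) ℂ :=
  chain hadamard (k + 1) (siteGate m s w)

/-- The state of the outer pair of qubits after the outcome string `s` for the graph basis state
`w`. -/
def outerVec (w : Fin (k + 2) → Fin 2) : Fin 2 × Fin 2 → ℂ := maxEntVec (outerUnitary m s w)

theorem conjTranspose_embed_mulVec_graphVec (w : Fin (k + 2) → Fin 2) :
    (embed m s)ᴴ *ᵥ graphVec w = ((1 / √2 : ℝ) : ℂ) ^ k • outerVec m s w := by
  ext p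
  rw [Pi.smul_apply, outerVec, outerUnitary, ← sum_prod_mul_clusterVec (coe_siteGate m s w),
    smul_eq_mul, Finset.mul_sum, mulVec, dotProduct]
  refine Finset.sum_congr rfl fun x _ => ?_
  simp only [conjTranspose_apply, embed, of_apply, Finset.prod_mul_distrib, mul_ite, mul_zero,
    apply_ite star, star_zero, ite_mul, zero_mul, graphVec, dotProduct, bitSign_sum]
  refine if_congr Iff.rfl ?_ rfl
  rw [prod_frame fun j => frame (1 : Fin 2 → ℂ) _ 1 j (x j)]
  simp only [frame_zero, frame_inner, frame_last, Pi.one_apply, Pi.star_apply, star_mul', star_pow,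
    star_prod, Complex.star_def, Complex.conj_ofReal, Complex.ofReal_prod]
  ring

theorem star_outerVec_dotProduct_self (w : Fin (k + 2) → Fin 2) :
    star (outerVec m s w) ⬝ᵥ outerVec m s w = 1 :=
  star_maxEntVec_dotProduct_self _

theorem star_outerVec_zero_dotProduct_single (i : Fin (k + 2)) :
    star (outerVec m s 0) ⬝ᵥ outerVec m s (Pi.single i 1) = 0 := by
  obtain ⟨g, hg⟩ := isConj_iff.1
    (isConj_inv_chain_mul_chain_update hadamard (pauliUnitary 3) (siteGate m s 0) i)
  have trace_conj : ((g * pauliUnitary 3 * g⁻¹ : unitaryGroup (Fin 2) ℂ) : QubitOp).trace = 0 := by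
    rw [UnitaryGroup.mul_val, trace_mul_comm, ← UnitaryGroup.mul_val, ← mul_assoc,
      inv_mul_cancel, one_mul]
    simp [pauliUnitary, pauliZ, trace]
  rw [hg, UnitaryGroup.mul_val, UnitaryGroup.inv_val] at trace_conj
  rw [outerVec, outerVec, star_maxEntVec_dotProduct, outerUnitary, outerUnitary, siteGate_single,
    ← star_eq_conjTranspose, trace_conj, zero_div]

end Outer

/-! ### The bound and the states that attain it -/

theorem fullyEntangledFraction_mixture {κ : Type} [Fintype κ] [Nonempty κ] {t : ℝ}
    {U : unitaryGroup (Fin 2) ℂ} {v : κ → Fin 2 × Fin 2 → ℂ} (h0 : 1 / 2 ≤ t) (h1 : t ≤ 1)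
    (hv : ∀ i, star (v i) ⬝ᵥ v i = 1) (hUv : ∀ i, star (maxEntVec U) ⬝ᵥ v i = 0) :
    fullyEntangledFraction (mixture t (maxEntVec U) v) = t := by
  have hU := star_maxEntVec_dotProduct_self U
  refine le_antisymm (ciSup_le fun W => ?_) ?_
  · rw [bellOverlap_eq_sandwich]
    exact sandwich_mixture_le h0 h1 hU hv hUv (star_maxEntVec_dotProduct_self _)
  · exact ((bellOverlap_map_star _ U).trans (sandwich_mixture_self hU hUv)).symm.trans_le
      (bellOverlap_le _ _)

theorem normSq_inv_sqrt_two_pow (k : ℕ) :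
    Complex.normSq (((1 / √2 : ℝ) : ℂ) ^ k) = (1 / 2) ^ k := by
  rw [map_pow, Complex.normSq_ofReal, div_mul_div_comm, Real.mul_self_sqrt zero_le_two, one_mul]

section Localization

variable {k : ℕ} (m : Fin k → MeasBasis)

/-- Bob's correction for the outcome string `s` and the Bell result `j`: a Pauli matrix, as in
standard teleportation, after the unitary that takes the outer pair of a measured cluster state to
`|φ⁺⟩`. -/
def corrections (s : Fin k → Fin 2) (j : Fin 4) : unitaryGroup (Fin 2) ℂ :=
  pauliUnitary j * UnitaryGroup.map_star (outerUnitary m s 0)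

theorem fidelityWith_corrections (s : Fin k → Fin 2) (τ : PairOp) :
    fidelityWith τ (corrections m s) = (τ.trace.re + 2 * sandwich (outerVec m s 0) τ) / 3 := by
  unfold corrections
  rw [fidelityWith_pauli_mul, bellOverlap_map_star, outerVec]

theorem outcomeProb_mul_fidelityWith_corrections (s : Fin k → Fin 2) {ρ : Op (k + 2)}
    (hρ : ρ.PosSemidef) :
    outcomeProb m ρ s * fidelityWith (postState m ρ s) (corrections m s) =
      (outcomeProb m ρ s + 2 * sandwich (outerVec m s 0) (outerState m s ρ)) / 3 := by
  rcases eq_or_ne (outcomeProb m ρ s) 0 with hp | hp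
  · have outerState_pos := posSemidef_outerState m s hρ
    have outerState_eq_zero : outerState m s ρ = 0 := by
      refine outerState_pos.trace_eq_zero_iff.1 (Complex.ext ?_ ?_)
      · rw [← outcomeProb_eq, hp, Complex.zero_re]
      · exact (Complex.le_def.1 outerState_pos.trace_nonneg).2.symm
    simp [hp, outerState_eq_zero, sandwich]
  · rw [fidelityWith_corrections, postState_eq, ← Complex.ofReal_inv, sandwich_smul_right,
      trace_smul, smul_eq_mul, Complex.re_ofReal_mul, ← outcomeProb_eq]
    field_simp

theorem sandwich_clusterVec_le {ρ : Op (k + 2)} (hρ : ρ.PosSemidef) :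
    sandwich (clusterVec (k + 2)) ρ ≤ ∑ s, sandwich (outerVec m s 0) (outerState m s ρ) := by
  have branch : ∀ s, embed m s *ᵥ ((embed m s)ᴴ *ᵥ clusterVec (k + 2)) =
      ((1 / √2 : ℝ) : ℂ) ^ k • (embed m s *ᵥ outerVec m s 0) := fun s => by
    rw [← graphVec_zero, conjTranspose_embed_mulVec_graphVec, mulVec_smul]
  calc sandwich (clusterVec (k + 2)) ρ
      = sandwich (∑ s, ((1 / √2 : ℝ) : ℂ) ^ k • (embed m s *ᵥ outerVec m s 0)) ρ := by
        simp only [← branch, sum_embed_mulVec]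
    _ ≤ Fintype.card (Fin k → Fin 2) *
          ∑ s, sandwich (((1 / √2 : ℝ) : ℂ) ^ k • (embed m s *ᵥ outerVec m s 0)) ρ :=
        sandwich_sum_le hρ _
    _ = ∑ s, sandwich (outerVec m s 0) (outerState m s ρ) := by
        simp only [sandwich_smul_left, normSq_inv_sqrt_two_pow, ← sandwich_outerState,
          ← Finset.mul_sum, ← mul_assoc]
        simp

theorem le_localizedFidelityWith_corrections {c : ℝ} {ρ : Op (k + 2)} (hρ : IsState ρ)
    (h : ∀ i, c ≤ expect (gen i) ρ) :
    (1 + 2 * wcWeight (k + 2) c) / 3 ≤ localizedFidelityWith m (corrections m) ρ := by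
  calc (1 + 2 * wcWeight (k + 2) c) / 3 ≤ (1 + 2 * sandwich (clusterVec (k + 2)) ρ) / 3 := by
        gcongr
        exact wcWeight_le_sandwich_clusterVec hρ h
    _ ≤ (1 + 2 * ∑ s, sandwich (outerVec m s 0) (outerState m s ρ)) / 3 := by
        gcongr
        exact sandwich_clusterVec_le m hρ.1
    _ = localizedFidelityWith m (corrections m) ρ := by
        simp only [localizedFidelityWith, outcomeProb_mul_fidelityWith_corrections m _ hρ.1]
        rw [← Finset.sum_div, Finset.sum_add_distrib, ← Finset.mul_sum, sum_outcomeProb, hρ.2,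
          Complex.one_re]

theorem localizedFidelityWith_le_localizedFidelity {ρ : Op (k + 2)} (hρ : ρ.PosSemidef)
    (V : (Fin k → Fin 2) → Fin 4 → unitaryGroup (Fin 2) ℂ) :
    localizedFidelityWith m V ρ ≤ localizedFidelity m ρ :=
  Finset.sum_le_sum fun s _ => mul_le_mul_of_nonneg_left
    (fidelityWith_le_teleportFidelity _ _) (outcomeProb_nonneg m s hρ)

variable (s : Fin k → Fin 2) (c : ℝ)

/-- The state of the outer pair of qubits that the outcome string `s` leaves of the worst-case
state. -/
def outerWcState : PairOp :=
  mixture (wcWeight (k + 2) c) (outerVec m s 0) fun i => outerVec m s (Pi.single i 1)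

theorem outerState_wcState : outerState m s (wcState (k + 2) c) =
    (((1 / 2 : ℝ) ^ k : ℝ) : ℂ) • outerWcState m s c := by
  have := mul_mixture_mul_conjTranspose (wcWeight (k + 2) c) (graphVec 0)
    (fun i : Fin (k + 2) => graphVec (Pi.single i 1)) (embed m s)ᴴ
  simp only [conjTranspose_embed_mulVec_graphVec, conjTranspose_conjTranspose] at this
  rw [outerState, wcState_eq_mixture, this, mixture_smul, normSq_inv_sqrt_two_pow, outerWcState]

theorem trace_outerWcState : (outerWcState m s c).trace = 1 :=
  trace_mixture (star_outerVec_dotProduct_self m s 0) fun _ => star_outerVec_dotProduct_self m s _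

theorem outcomeProb_wcState : outcomeProb m (wcState (k + 2) c) s = (1 / 2) ^ k := by
  rw [outcomeProb_eq, outerState_wcState, trace_smul, trace_outerWcState, smul_eq_mul, mul_one,
    Complex.ofReal_re]

theorem postState_wcState : postState m (wcState (k + 2) c) s = outerWcState m s c := by
  have prob_ne_zero : (((1 / 2 : ℝ) ^ k : ℝ) : ℂ) ≠ 0 := Complex.ofReal_ne_zero.2 (by positivity)
  rw [postState_eq, outerState_wcState, outcomeProb_wcState, inv_smul_smul₀ prob_ne_zero]

theorem fidelityWith_postState_wcState :
    fidelityWith (postState m (wcState (k + 2) c) s) (corrections m s) =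
      (1 + 2 * wcWeight (k + 2) c) / 3 := by
  rw [postState_wcState, fidelityWith_corrections, trace_outerWcState, outerWcState,
    sandwich_mixture_self (star_outerVec_dotProduct_self m s 0)
      (star_outerVec_zero_dotProduct_single m s), Complex.one_re]

theorem le_teleportFidelity_postState_wcState :
    (1 + 2 * wcWeight (k + 2) c) / 3 ≤ teleportFidelity (postState m (wcState (k + 2) c) s) :=
  (fidelityWith_postState_wcState m s c).symm.trans_le (fidelityWith_le_teleportFidelity _ _)

variable {c}

theorem teleportFidelity_postState_wcState (h0 : 1 / 2 ≤ wcWeight (k + 2) c)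
    (h1 : wcWeight (k + 2) c ≤ 1) :
    teleportFidelity (postState m (wcState (k + 2) c) s) = (1 + 2 * wcWeight (k + 2) c) / 3 := by
  rw [postState_wcState, teleportFidelity_eq, trace_outerWcState, Complex.one_re, outerWcState,
    outerVec, fullyEntangledFraction_mixture h0 h1 (fun _ => star_outerVec_dotProduct_self m s _)
      (star_outerVec_zero_dotProduct_single m s)]

theorem localizedFidelity_wcState (h0 : 1 / 2 ≤ wcWeight (k + 2) c)
    (h1 : wcWeight (k + 2) c ≤ 1) :
    localizedFidelity m (wcState (k + 2) c) = (1 + 2 * wcWeight (k + 2) c) / 3 := by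
  have isState := isState_wcState (one_half_pos.le.trans h0) h1
  simp only [localizedFidelity, teleportFidelity_postState_wcState m _ h0 h1]
  rw [← Finset.sum_mul, sum_outcomeProb, isState.2, Complex.one_re, one_mul]

end Localization

section Weight

variable {n : ℕ} {c : ℝ}

theorem one_sub_mul_eq_wcWeight (n : ℕ) (c : ℝ) :
    1 - (n : ℝ) / 3 * (1 - c) = (1 + 2 * wcWeight n c) / 3 := by
  rw [wcWeight]
  ring

theorem wcWeight_le_one (hc : c ≤ 1) : wcWeight n c ≤ 1 :=
  sub_le_self _ (div_nonneg (mul_nonneg n.cast_nonneg (sub_nonneg.2 hc)) zero_le_two)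

theorem wcWeight_nonneg (h : (n : ℝ) * (1 - c) ≤ 2) : 0 ≤ wcWeight n c := by
  rw [wcWeight]
  linarith

theorem half_le_wcWeight (h : (n : ℝ) * (1 - c) ≤ 1) : 1 / 2 ≤ wcWeight n c := by
  rw [wcWeight]
  linarith

end Weight

end LinearCluster

end

theorem mainTheorem3 :
    (∀ τ : LinearCluster.PairOp, LinearCluster.IsState τ →
      LinearCluster.teleportFidelity τ =
        (1 + 2 * LinearCluster.fullyEntangledFraction τ) / 3) ∧
    ∀ (k : ℕ) (m : Fin k → LinearCluster.MeasBasis),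
      (∀ (c : ℝ) (ρ : LinearCluster.Op (k + 2)), LinearCluster.IsState ρ →
        (∀ i, c ≤ LinearCluster.expect (LinearCluster.gen i) ρ) →
        1 - ((k + 2 : ℕ) : ℝ) / 3 * (1 - c) ≤ LinearCluster.localizedFidelity m ρ) ∧
      (∃ V : (Fin k → Fin 2) → Fin 4 → Matrix.unitaryGroup (Fin 2) ℂ,
        (∀ (c : ℝ) (ρ : LinearCluster.Op (k + 2)), LinearCluster.IsState ρ →
          (∀ i, c ≤ LinearCluster.expect (LinearCluster.gen i) ρ) →
          1 - ((k + 2 : ℕ) : ℝ) / 3 * (1 - c) ≤ LinearCluster.localizedFidelityWith m V ρ) ∧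
        (∀ c : ℝ, c ≤ 1 → ((k + 2 : ℕ) : ℝ) * (1 - c) ≤ 2 → ∀ s : Fin k → Fin 2,
          LinearCluster.fidelityWith
            (LinearCluster.postState m (LinearCluster.wcState (k + 2) c) s) (V s) =
              1 - ((k + 2 : ℕ) : ℝ) / 3 * (1 - c))) ∧
      (∀ c : ℝ, c ≤ 1 → ((k + 2 : ℕ) : ℝ) * (1 - c) ≤ 2 →
        LinearCluster.IsState (LinearCluster.wcState (k + 2) c) ∧
        (∀ i, LinearCluster.expect (LinearCluster.gen i) (LinearCluster.wcState (k + 2) c) = c) ∧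
        ∀ s : Fin k → Fin 2,
          0 < LinearCluster.outcomeProb m (LinearCluster.wcState (k + 2) c) s ∧
          1 - ((k + 2 : ℕ) : ℝ) / 3 * (1 - c) ≤ LinearCluster.teleportFidelity
            (LinearCluster.postState m (LinearCluster.wcState (k + 2) c) s)) ∧
      (∀ c : ℝ, c ≤ 1 → ((k + 2 : ℕ) : ℝ) * (1 - c) ≤ 1 →
        (∀ s : Fin k → Fin 2, LinearCluster.teleportFidelity
          (LinearCluster.postState m (LinearCluster.wcState (k + 2) c) s) =
            1 - ((k + 2 : ℕ) : ℝ) / 3 * (1 - c)) ∧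
        LinearCluster.localizedFidelity m (LinearCluster.wcState (k + 2) c) =
          1 - ((k + 2 : ℕ) : ℝ) / 3 * (1 - c)) := by
  simp only [LinearCluster.one_sub_mul_eq_wcWeight]
  refine ⟨fun τ hτ => ?_, fun k m => ⟨fun c ρ hρ h => ?_, ⟨LinearCluster.corrections m, ?_, ?_⟩,
    fun c hc h => ⟨?_, ?_, fun s => ⟨?_, ?_⟩⟩, fun c hc h => ?_⟩⟩
  · rw [LinearCluster.teleportFidelity_eq, hτ.2, Complex.one_re]
  · exact (LinearCluster.le_localizedFidelityWith_corrections m hρ h).trans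
      (LinearCluster.localizedFidelityWith_le_localizedFidelity m hρ.1 _)
  · exact fun c ρ hρ h => LinearCluster.le_localizedFidelityWith_corrections m hρ h
  · exact fun c _ _ s => LinearCluster.fidelityWith_postState_wcState m s c
  · exact LinearCluster.isState_wcState (LinearCluster.wcWeight_nonneg h)
      (LinearCluster.wcWeight_le_one hc)
  · exact LinearCluster.expect_gen_wcState c
  · exact LinearCluster.outcomeProb_wcState m s c ▸ by positivity
  · exact LinearCluster.le_teleportFidelity_postState_wcState m s c
  · have half_le := LinearCluster.half_le_wcWeight h
    have le_one := LinearCluster.wcWeight_le_one (n := k + 2) hc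
    exact ⟨fun s => LinearCluster.teleportFidelity_postState_wcState m s half_le le_one,
      LinearCluster.localizedFidelity_wcState m half_le le_one⟩
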